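/- For a permutation $\sigma\in S_n$ written as the product $\sigma=\kappa_1\cdots\kappa_\omega$ of all its independent cycles (fixed points count as cycles of length $1$), let $|\kappa_i|$ be the length of $\kappa_i$. A function $f:S_n\to\mathbb C$ is multiplicative with cycle values $\hat f(1),\dots,\hat f(n)\in\mathbb C$ if $f(\sigma)=\prod_{i=1}^{\omega}\hat f(|\kappa_i|)$ for all $\sigma\in S_n$. Let $0<d^-\le d^+$. There is a positive constant $c=c(d^-,d^+)$, depending on $d^-$ and $d^+$ only, such that the following holds for every integer $n\ge 1$, all real numbers $d_1,\dots,d_n$ with $d^-\le d_j\le d^+$ $(1\le j\le n)$, and every multiplicative function $f:S_n\to\mathbb C$ with cycle values satisfying $|\hat f(j)|\le 1$ for $1\le j\le n$ (so that $|f(\sigma)|\le 1$ for all $\sigma\in S_n$). For $0\le m\le n$ and $\sigma\in S_m$ let $d(\sigma)$ be the product of $d_{|\kappa|}$ over all cycles $\kappa$ of $\sigma$, and put $$p_m=\frac1{m!}\sum_{\sigma\in S_m}d(\sigma)\quad(p_0=1),\qquad \nu_{n,d}(\{\sigma\})=\frac{d(\sigma)}{\sum_{w\in S_n}d(w)},\qquad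 M_n^d(f)=\sum_{\sigma\in S_n}f(\sigma)\,\nu_{n,d}(\{\sigma\}),$$ $$\Delta_n=\left|M_n^d(f)-\exp\left\{\sum_{k=1}^n d_k\frac{\hat f(k)-1}{k}\right\}\right|.$$ If $d^-<1$, then $$\Delta_n\le c\left(\Bigl(\sum_{j=0}^n p_j\Bigr)^{-1}\sum_{k=1}^n|\hat f(k)-1|\,p_{n-k}+\frac1{n^{d^-}}\sum_{k=1}^n|\hat f(k)-1|\,k^{d^--1}+\frac1n\sum_{k=1}^n|\hat f(k)-1|\right),$$ and if $d^-\ge 1$, then $$\Delta_n\le c\left(\Bigl(\sum_{j=0}^n p_j\Bigr)^{-1}\sum_{k=1}^n|\hat f(k)-1|\,p_{n-k}+\frac1n\sum_{k=1}^n|\hat f(k)-1|\Bigl(1+\log\frac nk\Bigr)\right).$$ -/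

import Mathlib

/-- The product `∏ a(|κ|)` over all independent cycles `κ` of `σ ∈ S_n`, where `|κ|` is the length
of `κ`.  Fixed points of `σ` count as cycles of length `1`: `σ.partition` is the partition of `n`
formed by the lengths of all cycles of `σ`, fixed points included. -/
def cycleProd {R : Type*} [CommMonoid R] (a : ℕ → R) {n : ℕ} (σ : Equiv.Perm (Fin n)) : R :=
  (σ.partition.parts.map a).prod

/-- `f : S_n → ℂ` is multiplicative, and `fhat j` is its value on the cycles of length `j`. -/
def IsMultiplicativeWith {n : ℕ} (f : Equiv.Perm (Fin n) → ℂ) (fhat : ℕ → ℂ) : Prop :=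
  ∀ σ : Equiv.Perm (Fin n), f σ = cycleProd fhat σ

/-- The mass `ν_{n,d}({σ}) = d(σ) / ∑_{w ∈ S_n} d(w)`, where `d` is the multiplicative function
with value `d j` on the cycles of length `j`. -/
noncomputable def cycleMeasure (d : ℕ → ℝ) {n : ℕ} (σ : Equiv.Perm (Fin n)) : ℝ :=
  cycleProd d σ / ∑ w : Equiv.Perm (Fin n), cycleProd d w

/-- The weighted mean `M_n^d(f) = ∑_{σ ∈ S_n} f(σ) ν_{n,d}({σ})`. -/
noncomputable def weightedMean (d : ℕ → ℝ) {n : ℕ} (f : Equiv.Perm (Fin n) → ℂ) : ℂ :=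
  ∑ σ : Equiv.Perm (Fin n), f σ * (cycleMeasure d σ : ℂ)

/-- `p_m = (1 / m!) ∑_{σ ∈ S_m} d(σ)`. -/
noncomputable def cyclePartition (d : ℕ → ℝ) (m : ℕ) : ℝ :=
  (1 / (m.factorial : ℝ)) * ∑ σ : Equiv.Perm (Fin m), cycleProd d σ

/-- `Δ_n = |M_n^d(f) - exp(∑_{k=1}^n d_k (fhat k - 1) / k)|`. -/
noncomputable def meanError (d : ℕ → ℝ) {n : ℕ} (f : Equiv.Perm (Fin n) → ℂ) (fhat : ℕ → ℂ) : ℝ :=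
  ‖weightedMean d f -
    Complex.exp (∑ k ∈ Finset.Icc 1 n, (d k : ℂ) * ((fhat k - 1) / (k : ℂ)))‖

/-! Write `p(z) = exp (∑ d k z^k / k)` and `g(z) = exp (∑ b k z^k / k)` with `b k = d k (fhat k -
1)`, all weights being cut off at `n`. Counting permutations by cycle type shows that `p_m` is the
coefficient of `z^m` in `p`, and that the weighted mean is the quotient of the `n`-th coefficients
of `g p` and `p` (`weightedMean_eq`). The claim is that this quotient is close to `g(1)`.

The coefficients of `g(xz) p(z)` move from those of `p` at `x = 0` to those of `g p` at `x = 1`,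
while `g(x)` moves from `1` to `g(1)`. With `q(z) = p(z) / p(xz) = exp (∑ d k (1 - x^k) z^k / k)`,
the `x`-derivative is `z (g' p)(xz) q(z)`, whose `l`-th coefficient is `∑ S_m x^m q_{l-1-m}`, where
`S_m` are the coefficients of `g' p`. Since `∑ S_m x^m = g'(x) p(x)`, its distance from `p_l g'(x)`
is controlled by the differences `q_{l-1-m} - p_l / p(x)`, and `p_l / p(x)` is itself an average of
shifts of `q`. So everything rests on the `ℓ¹` smoothness of `q` under shifts
(`sum_abs_expCoeff_sub_delay_le`).

For that, let `θ ≤ 1` be a lower bound for the `d k` and split off the factor `((1 - xz) / (1 -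
z))^θ` from `q`. By a Kaluza-type argument its coefficients decrease
(`antitone_expCoeff_mul_one_sub_pow`), so their shifts telescope. The remaining factor has
nonnegative coefficients whose sum, multiplied by `p(x)`, is at most a constant times `(p_0 + ... +
p_n) (n (1 - x))^(-θ)` (`sum_expCoeff_sub_mul_exp_le`).

Integrating over `0 ≤ x ≤ 1 - 1/n`, with a crude bound on the last stretch up to `1`, yields an `ℓ¹`
estimate over all indices `l ≤ n` (`sum_norm_expCoeff_sub_le`). The recurrence for the coefficients
upgrades it to the single index `n` (`mul_norm_expCoeff_sub_le`). The kernel integrals give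
`k^(θ-1)` when `θ < 1` and a logarithm when `θ = 1`. -/

/-- The coefficients of the formal power series `exp (∑ w k z ^ k / k)`. -/
noncomputable def expCoeff {K : Type*} [Field K] (w : ℕ → K) : ℕ → K
  | 0 => 1
  | n + 1 => (∑ i : Fin (n + 1), w (i + 1) * expCoeff w (n - i)) / ((n : K) + 1)

/-! ### Exponential coefficients and their recurrence. -/

section ExpCoeff

variable {K : Type*} [Field K]

@[simp] theorem expCoeff_zero (w : ℕ → K) : expCoeff w 0 = 1 := by
  rw [expCoeff]

theorem expCoeff_succ (w : ℕ → K) (n : ℕ) :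
    expCoeff w (n + 1) =
      (∑ i ∈ Finset.range (n + 1), w (i + 1) * expCoeff w (n - i)) / ((n : K) + 1) := by
  rw [expCoeff, Finset.sum_range]

theorem succ_mul_expCoeff [CharZero K] (w : ℕ → K) (n : ℕ) :
    ((n : K) + 1) * expCoeff w (n + 1) =
      ∑ i ∈ Finset.range (n + 1), w (i + 1) * expCoeff w (n - i) := by
  rw [expCoeff_succ]
  field_simp [Nat.cast_add_one_ne_zero n]

/-- This permits cutting the weights off beyond `n`, which turns the exponent into a polynomial and
makes evaluation at any point legitimate. -/
theorem expCoeff_congr {w w' : ℕ → K} {n : ℕ} (h : ∀ k, 1 ≤ k → k ≤ n → w k = w' k) :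
    expCoeff w n = expCoeff w' n := by
  induction n using Nat.strong_induction_on with
  | _ n ih =>
    cases n with
    | zero => simp
    | succ n =>
      rw [expCoeff_succ, expCoeff_succ]
      congr 1
      refine Finset.sum_congr rfl fun i hi => ?_
      have hi' := Finset.mem_range.1 hi
      rw [h (i + 1) (by omega) (by omega),
        ih (n - i) (by omega) fun k hk hk' => h k hk (by omega)]

/-- The sequence of coefficients is determined by its recurrence. -/
theorem eq_expCoeff [CharZero K] (w c : ℕ → K) (h0 : c 0 = 1)
    (h : ∀ n : ℕ, ((n : K) + 1) * c (n + 1) =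
      ∑ i ∈ Finset.range (n + 1), w (i + 1) * c (n - i)) (n : ℕ) : c n = expCoeff w n := by
  induction n using Nat.strong_induction_on with
  | _ n ih =>
    cases n with
    | zero => simp [h0]
    | succ n =>
      have hn : (n : K) + 1 ≠ 0 := Nat.cast_add_one_ne_zero n
      apply mul_left_cancel₀ hn
      rw [h, succ_mul_expCoeff]
      exact Finset.sum_congr rfl fun i _ => by rw [ih (n - i) (by omega)]

end ExpCoeff

/-! ### The exponential formula for sums over permutations. -/

section Partitions

/-- The product of the factorials of the multiplicities of a multiset. -/
def multFactorial (m : Multiset ℕ) : ℕ := ∏ i ∈ m.toFinset, (m.count i).factorial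

theorem multFactorial_eq_prod (m : Multiset ℕ) {s : Finset ℕ} (hs : m.toFinset ⊆ s) :
    multFactorial m = ∏ i ∈ s, (m.count i).factorial := by
  refine Finset.prod_subset hs fun i _ hi => ?_
  rw [Multiset.count_eq_zero_of_notMem (by simpa using hi), Nat.factorial_zero]

theorem multFactorial_cons (k : ℕ) (m : Multiset ℕ) :
    multFactorial (k ::ₘ m) = (m.count k + 1) * multFactorial m := by
  have hk : k ∈ insert k m.toFinset := Finset.mem_insert_self _ _
  rw [multFactorial_eq_prod (k ::ₘ m) (s := insert k m.toFinset) (by simp),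
    multFactorial_eq_prod m (s := insert k m.toFinset) (Finset.subset_insert _ _),
    ← Finset.mul_prod_erase _ _ hk, ← Finset.mul_prod_erase _ _ hk, Multiset.count_cons_self,
    Nat.factorial_succ, mul_assoc]
  congr 2
  refine Finset.prod_congr rfl fun i hi => ?_
  rw [Multiset.count_cons_of_ne (Finset.ne_of_mem_erase hi)]

theorem multFactorial_pos (m : Multiset ℕ) : 0 < multFactorial m :=
  Finset.prod_pos fun _ _ => Nat.factorial_pos _

-- `Equiv.Perm.cycleType` omits fixed points while `Equiv.Perm.partition` keeps them, so the parts
-- are split into those at least `2` and a block of ones. The factorial of the number of fixed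
-- points in the count by cycle type is then the multiplicity factor of the part `1`.
open Equiv.Perm in
theorem card_partition_eq_mul {α : Type*} [Fintype α] [DecidableEq α]
    (p : (Fintype.card α).Partition) :
    (Finset.univ.filter fun σ : Equiv.Perm α => σ.partition = p).card *
      (p.parts.prod * multFactorial p.parts) = (Fintype.card α).factorial := by
  set m := p.parts.filter fun n => 2 ≤ n with hm
  set r := p.parts.filter fun n => ¬ 2 ≤ n with hr
  have hsplit : m + r = p.parts := Multiset.filter_add_not _ _
  have hr1 : r = Multiset.replicate (Multiset.card r) 1 := by
    rw [Multiset.eq_replicate_card]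
    intro b hb
    have h1 := Multiset.mem_filter.1 hb
    have h2 := p.parts_pos h1.1
    omega
  have hsum : m.sum + Multiset.card r = Fintype.card α := by
    have := p.parts_sum
    rw [← hsplit, Multiset.sum_add, hr1] at this
    simpa using this
  have hfilter : (Finset.univ.filter fun σ : Equiv.Perm α => σ.partition = p) =
      Finset.univ.filter fun σ : Equiv.Perm α => σ.cycleType = m := by
    ext σ
    simp only [Finset.mem_filter, Finset.mem_univ, true_and]
    constructor
    · intro h
      rw [← filter_parts_partition_eq_cycleType, h]
    · intro h
      ext1
      rw [parts_partition, ← sum_cycleType, h, ← hsplit, hr1]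
      congr 2
      omega
  have hmain := card_of_cycleType_mul_eq α m
  rw [if_pos ⟨by omega, fun a ha => (Multiset.mem_filter.1 ha).2⟩] at hmain
  rw [hfilter, ← hmain]
  congr 1
  have hprod : p.parts.prod = m.prod := by
    rw [← hsplit, Multiset.prod_add, hr1]; simp
  have h1m : 1 ∉ m.toFinset := by
    simp [hm]
  have hfac : multFactorial p.parts =
      (Fintype.card α - m.sum).factorial * ∏ n ∈ m.toFinset, (m.count n).factorial := by
    rw [multFactorial_eq_prod p.parts (s := insert 1 m.toFinset), Finset.prod_insert h1m]
    · congr 1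
      · congr 1
        rw [← hsplit, Multiset.count_add, hr1, Multiset.count_replicate_self,
          Multiset.count_eq_zero_of_notMem (by simpa using h1m)]
        omega
      · refine Finset.prod_congr rfl fun i hi => ?_
        have : i ≠ 1 := fun h => h1m (h ▸ hi)
        rw [← hsplit, Multiset.count_add, hr1, Multiset.count_replicate, if_neg this.symm, add_zero]
    · intro i hi
      rw [Multiset.mem_toFinset, ← hsplit, Multiset.mem_add] at hi
      rw [Finset.mem_insert, Multiset.mem_toFinset]
      rcases hi with hi | hi
      · exact Or.inr hi
      · rw [hr1] at hi
        exact Or.inl (Multiset.eq_of_mem_replicate hi)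
  rw [hprod, hfac]
  ring

variable {K : Type*} [Field K] [CharZero K]

/-- The contribution of one cycle type to the average of a multiplicative function. -/
noncomputable def partitionWeight (a : ℕ → K) (m : Multiset ℕ) : K :=
  (m.map a).prod / ((m.prod : K) * (multFactorial m : K))

theorem partitionWeight_cons (a : ℕ → K) {k : ℕ} (hk : 1 ≤ k) (m : Multiset ℕ) :
    ((k * (k ::ₘ m).count k : ℕ) : K) * partitionWeight a (k ::ₘ m) =
      a k * partitionWeight a m := by
  have h1 : (k : K) ≠ 0 := Nat.cast_ne_zero.2 (by omega)
  have h2 : ((m.count k : K) + 1) ≠ 0 := Nat.cast_add_one_ne_zero _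
  rw [partitionWeight, partitionWeight, multFactorial_cons, Multiset.count_cons_self,
    Multiset.map_cons, Multiset.prod_cons, Multiset.prod_cons]
  simp only [Nat.cast_mul, Nat.cast_add, Nat.cast_one]
  by_cases h3 : (m.prod : K) * (multFactorial m : K) = 0
  · rw [show (k : K) * (m.prod : K) * ((m.count k + 1) * (multFactorial m : K)) =
      k * (m.count k + 1) * ((m.prod : K) * (multFactorial m : K)) by ring, h3]
    simp
  · field_simp

/-- The recurrence comes from weighting each partition of `n + 1` by its size `∑ k * count k`.
Partitions containing `k` correspond to partitions of `n + 1 - k` by removing one part `k`, and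
`partitionWeight_cons` tracks the weight. -/
theorem sum_partitionWeight (a : ℕ → K) (n : ℕ) :
    ∑ p : n.Partition, partitionWeight a p.parts = expCoeff a n := by
  refine eq_expCoeff a (fun n => ∑ p : n.Partition, partitionWeight a p.parts) ?_ ?_ n
  · simp [partitionWeight, multFactorial]
  · intro n
    have hp : ∀ p : (n + 1).Partition, ((n : K) + 1) * partitionWeight a p.parts =
        ∑ i ∈ Finset.range (n + 1), (((i + 1) * p.parts.count (i + 1) : ℕ) : K) *
          partitionWeight a p.parts := by
      intro p
      rw [← Finset.sum_mul]
      congr 1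
      have h := p.parts_sum
      rw [Finset.sum_multiset_count_of_subset p.parts (Finset.Icc 1 (n + 1))] at h
      · rw [← Nat.cast_add_one, ← Nat.cast_sum, Nat.cast_inj, Finset.range_eq_Ico,
          Finset.sum_Ico_add' (fun i => i * p.parts.count i) 0 (n + 1) 1]
        refine h.symm.trans (Finset.sum_congr rfl fun i _ => ?_)
        rw [smul_eq_mul, mul_comm]
      · intro i hi
        have hi := Multiset.mem_toFinset.1 hi
        exact Finset.mem_Icc.2 ⟨p.parts_pos hi, Nat.Partition.le_of_mem_parts hi⟩
    rw [Finset.mul_sum, Finset.sum_congr rfl fun p _ => hp p, Finset.sum_comm]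
    refine Finset.sum_congr rfl fun i hi => ?_
    have hi := Finset.mem_range.1 hi
    rw [← Finset.sum_filter_add_sum_filter_not Finset.univ
      (fun p : (n + 1).Partition => i + 1 ∈ p.parts)]
    rw [Finset.sum_eq_zero (s := Finset.univ.filter fun p : (n + 1).Partition => ¬ i + 1 ∈ p.parts),
      add_zero]
    · rw [← Finset.sum_subtype_eq_sum_filter, Finset.subtype_univ, Finset.mul_sum,
        show n - i = n + 1 - (i + 1) by omega,
        ← Equiv.sum_comp
          (Nat.Partition.partitionWithPartEquiv (n := n + 1) (a := i + 1)
            (by omega) (by omega)).symm]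
      refine Finset.sum_congr rfl fun q _ => ?_
      rw [Nat.Partition.partitionWithPartEquiv_symm_apply_parts]
      exact partitionWeight_cons a (by omega) q.parts
    · intro p hp
      rw [Multiset.count_eq_zero_of_notMem (Finset.mem_filter.1 hp).2]
      simp

theorem sum_perm_eq_expCoeff {α : Type*} [Fintype α] [DecidableEq α] (a : ℕ → K) :
    (∑ σ : Equiv.Perm α, (σ.partition.parts.map a).prod) =
      ((Fintype.card α).factorial : K) * expCoeff a (Fintype.card α) := by
  rw [← sum_partitionWeight, Finset.mul_sum,
    ← Finset.sum_fiberwise Finset.univ (fun σ : Equiv.Perm α => σ.partition)]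
  refine Finset.sum_congr rfl fun p _ => ?_
  rw [Finset.sum_congr rfl (g := fun _ => (p.parts.map a).prod)
    (fun σ hσ => by rw [(Finset.mem_filter.1 hσ).2]), Finset.sum_const, nsmul_eq_mul,
    ← card_partition_eq_mul p, partitionWeight]
  have h1 : (p.parts.prod : K) ≠ 0 := by
    rw [Nat.cast_ne_zero]
    exact Multiset.prod_ne_zero fun h => lt_irrefl 0 (p.parts_pos h)
  have h2 : (multFactorial p.parts : K) ≠ 0 := Nat.cast_ne_zero.2 (multFactorial_pos _).ne'
  simp only [Nat.cast_mul]
  field_simp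

theorem sum_cycleProd (a : ℕ → K) (n : ℕ) :
    ∑ σ : Equiv.Perm (Fin n), cycleProd a σ = (n.factorial : K) * expCoeff a n := by
  simpa [cycleProd] using sum_perm_eq_expCoeff (α := Fin n) a

theorem cyclePartition_eq (d : ℕ → ℝ) (n : ℕ) : cyclePartition d n = expCoeff d n := by
  rw [cyclePartition, sum_cycleProd]
  field_simp

end Partitions

/-! ### Products and dilations of exponential series. -/

section ExpCoeffAlgebra

variable {K : Type*} [Field K] [CharZero K]

theorem derivative_mk_expCoeff (w : ℕ → K) :
    PowerSeries.derivative K (PowerSeries.mk (expCoeff w)) =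
      PowerSeries.mk (fun k => w (k + 1)) * PowerSeries.mk (expCoeff w) := by
  ext n
  rw [PowerSeries.coeff_derivative, PowerSeries.coeff_mk, PowerSeries.coeff_mul,
    Finset.Nat.sum_antidiagonal_eq_sum_range_succ_mk, mul_comm, succ_mul_expCoeff]
  simp

/-- By the Leibniz rule the product has logarithmic derivative the sum of the two, hence it
satisfies the recurrence that characterizes the left side. -/
theorem mk_expCoeff_add (w w' : ℕ → K) :
    PowerSeries.mk (expCoeff fun k => w k + w' k) =
      PowerSeries.mk (expCoeff w) * PowerSeries.mk (expCoeff w') := by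
  ext n
  rw [PowerSeries.coeff_mk]
  symm
  refine eq_expCoeff _
    (fun n => PowerSeries.coeff n (PowerSeries.mk (expCoeff w) * PowerSeries.mk (expCoeff w')))
    ?_ ?_ n
  · simp [PowerSeries.coeff_mul]
  · intro n
    have h := congrArg (PowerSeries.coeff n) (Derivation.leibniz (PowerSeries.derivative K)
      (PowerSeries.mk (expCoeff w)) (PowerSeries.mk (expCoeff w')))
    rw [PowerSeries.coeff_derivative, derivative_mk_expCoeff, derivative_mk_expCoeff] at h
    rw [mul_comm, h]
    have h2 : ∀ P Q W W' : PowerSeries K, P • (W' * Q) + Q • (W * P) = (W + W') * (P * Q) := by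
      intro P Q W W'
      simp only [smul_eq_mul]
      ring
    rw [h2, PowerSeries.coeff_mul, Finset.Nat.sum_antidiagonal_eq_sum_range_succ_mk]
    simp

theorem expCoeff_add (w w' : ℕ → K) (n : ℕ) :
    expCoeff (fun k => w k + w' k) n =
      ∑ i ∈ Finset.range (n + 1), expCoeff w i * expCoeff w' (n - i) := by
  have h := congrArg (PowerSeries.coeff n) (mk_expCoeff_add w w')
  rw [PowerSeries.coeff_mul, Finset.Nat.sum_antidiagonal_eq_sum_range_succ_mk] at h
  simpa using h

theorem expCoeff_mul_pow (w : ℕ → K) (x : K) (n : ℕ) :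
    expCoeff (fun k => w k * x ^ k) n = expCoeff w n * x ^ n := by
  symm
  refine eq_expCoeff _ (fun n => expCoeff w n * x ^ n) (by simp) (fun n => ?_) n
  rw [← mul_assoc, succ_mul_expCoeff, Finset.sum_mul]
  refine Finset.sum_congr rfl fun i hi => ?_
  have hi := Finset.mem_range.1 hi
  obtain ⟨j, rfl⟩ := Nat.exists_eq_add_of_le (show i ≤ n by omega)
  rw [Nat.add_sub_cancel_left]
  ring

theorem expCoeff_map {L : Type*} [Field L] [CharZero L] (φ : K →+* L) (w : ℕ → K) (n : ℕ) :
    expCoeff (fun k => φ (w k)) n = φ (expCoeff w n) := by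
  symm
  refine eq_expCoeff _ (fun n => φ (expCoeff w n)) (by simp) (fun n => ?_) n
  have h := congrArg φ (succ_mul_expCoeff w n)
  simpa using h

theorem expCoeff_ofReal (w : ℕ → ℝ) (n : ℕ) :
    expCoeff (fun k => ((w k : ℝ) : ℂ)) n = ((expCoeff w n : ℝ) : ℂ) :=
  expCoeff_map (L := ℂ) Complex.ofRealHom w n

theorem expCoeff_zero_weight {K : Type*} [Field K] (n : ℕ) :
    expCoeff (fun _ => (0 : K)) (n + 1) = 0 := by
  simp [expCoeff_succ]

/-- A single nonzero weight. -/
theorem expCoeff_single (a : K) {k : ℕ} (hk : 1 ≤ k) (n : ℕ) :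
    expCoeff (fun j => if j = k then a else 0) n =
      if k ∣ n then (a / (k : K)) ^ (n / k) / ((n / k).factorial : K) else 0 := by
  symm
  refine eq_expCoeff _
    (fun n => if k ∣ n then (a / (k : K)) ^ (n / k) / ((n / k).factorial : K) else 0)
    (by simp) (fun n => ?_) n
  have hk0 : (k : K) ≠ 0 := Nat.cast_ne_zero.2 (by omega)
  by_cases hkn : k ≤ n + 1
  · rw [Finset.sum_eq_single_of_mem (k - 1) (Finset.mem_range.2 (by omega))]
    · rw [if_pos (Nat.sub_add_cancel hk)]
      have hd : k ∣ n - (k - 1) ↔ k ∣ n + 1 := by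
        rw [show n - (k - 1) = n + 1 - k by omega]
        exact ⟨fun h => by simpa [Nat.sub_add_cancel hkn] using Nat.dvd_add h (dvd_refl k),
          fun h => Nat.dvd_sub h (dvd_refl k)⟩
      simp only [hd]
      split_ifs with h
      · obtain ⟨m, hm⟩ := h
        obtain ⟨m, rfl⟩ : ∃ j, m = j + 1 :=
          Nat.exists_eq_succ_of_ne_zero (by rintro rfl; simp at hm)
        have hc : (n : K) + 1 = k * (m + 1) := by exact_mod_cast hm
        have h1 : n - (k - 1) = k * m := by
          rw [Nat.mul_succ] at hm
          omega
        have hm0 : (m : K) + 1 ≠ 0 := Nat.cast_add_one_ne_zero m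
        rw [hm, hc, h1, Nat.mul_div_cancel_left _ (by omega),
          Nat.mul_div_cancel_left _ (by omega), Nat.factorial_succ, pow_succ]
        push_cast
        have hf : (m.factorial : K) ≠ 0 := Nat.cast_ne_zero.2 (Nat.factorial_ne_zero _)
        field_simp
      · simp
    · intro b _ hb
      rw [if_neg (by omega), zero_mul]
  · rw [if_neg fun h => hkn (Nat.le_of_dvd (by omega) h), mul_zero, Finset.sum_eq_zero]
    intro i hi
    have := Finset.mem_range.1 hi
    rw [if_neg (by omega), zero_mul]

end ExpCoeffAlgebra

/-! ### Positivity and domination of coefficients. -/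

section ExpCoeffOrder

theorem expCoeff_nonneg {w : ℕ → ℝ} {n : ℕ} (h : ∀ k, 1 ≤ k → k ≤ n → 0 ≤ w k) :
    0 ≤ expCoeff w n := by
  induction n using Nat.strong_induction_on with
  | _ n ih =>
    cases n with
    | zero => simp
    | succ n =>
      rw [expCoeff_succ]
      refine div_nonneg (Finset.sum_nonneg fun i hi => ?_) (by positivity)
      have := Finset.mem_range.1 hi
      exact mul_nonneg (h _ (by omega) (by omega))
        (ih _ (by omega) fun k hk hk' => h k hk (by omega))

theorem norm_expCoeff_le {w : ℕ → ℂ} {v : ℕ → ℝ} {n : ℕ}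
    (h : ∀ k, 1 ≤ k → k ≤ n → ‖w k‖ ≤ v k) : ‖expCoeff w n‖ ≤ expCoeff v n := by
  induction n using Nat.strong_induction_on with
  | _ n ih =>
    cases n with
    | zero => simp
    | succ n =>
      rw [expCoeff_succ, expCoeff_succ, norm_div]
      have hn : ‖(n : ℂ) + 1‖ = (n : ℝ) + 1 := by
        rw [← Nat.cast_add_one, Complex.norm_natCast, Nat.cast_add_one]
      rw [hn]
      refine div_le_div_of_nonneg_right ((norm_sum_le _ _).trans (Finset.sum_le_sum fun i hi => ?_))
        (by positivity)
      have := Finset.mem_range.1 hi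
      rw [norm_mul]
      exact mul_le_mul (h _ (by omega) (by omega))
        (ih _ (by omega) fun k hk hk' => h k hk (by omega)) (norm_nonneg _)
        ((norm_nonneg _).trans (h _ (by omega) (by omega)))

theorem expCoeff_mono {w v : ℕ → ℝ} {n : ℕ} (h0 : ∀ k, 1 ≤ k → k ≤ n → 0 ≤ w k)
    (h : ∀ k, 1 ≤ k → k ≤ n → w k ≤ v k) : expCoeff w n ≤ expCoeff v n := by
  have h1 := norm_expCoeff_le (w := fun k => (w k : ℂ)) (v := v) (n := n) fun k hk hk' => by
    rw [Complex.norm_real, Real.norm_of_nonneg (h0 k hk hk')]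
    exact h k hk hk'
  rw [expCoeff_ofReal, Complex.norm_real, Real.norm_eq_abs] at h1
  exact (le_abs_self _).trans h1

end ExpCoeffOrder

/-! ### Evaluating exponential series with finitely many weights. -/

section ExpCoeffSum

theorem hasSum_expCoeff_single (a : ℂ) {k : ℕ} (hk : 1 ≤ k) :
    Summable (fun n => ‖expCoeff (fun j => if j = k then a else 0) n‖) ∧
      HasSum (expCoeff fun j => if j = k then a else 0) (Complex.exp (a / k)) := by
  have hinj : Function.Injective fun m : ℕ => k * m := fun m m' h =>
    Nat.eq_of_mul_eq_mul_left (by omega) h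
  have hval : ∀ m : ℕ, expCoeff (fun j => if j = k then a else 0) (k * m) =
      (a / k) ^ m / (m.factorial : ℂ) := by
    intro m
    rw [expCoeff_single a hk, if_pos (dvd_mul_right k m), Nat.mul_div_cancel_left _ (by omega)]
  have hzero : ∀ n, n ∉ Set.range (fun m : ℕ => k * m) →
      expCoeff (fun j => if j = k then a else 0) n = 0 := by
    intro n hn
    rw [expCoeff_single a hk, if_neg]
    rintro ⟨m, rfl⟩
    exact hn ⟨m, rfl⟩
  constructor
  · rw [← hinj.summable_iff (fun n hn => by rw [hzero n hn, norm_zero])]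
    refine (Real.summable_pow_div_factorial ‖a / k‖).congr fun m => ?_
    simp only [Function.comp_apply, hval]
    rw [norm_div (_ ^ m), norm_pow, Complex.norm_natCast]
  · rw [← hinj.hasSum_iff hzero]
    have h := NormedSpace.expSeries_div_hasSum_exp (𝔸 := ℂ) (a / k)
    rw [← Complex.exp_eq_exp_ℂ] at h
    exact (funext hval : (expCoeff fun j => if j = k then a else 0) ∘ (fun m : ℕ => k * m) = _) ▸ h

/-- One weight is added at a time: a single weight gives the ordinary exponential series in `z^k`,
and absolutely convergent Cauchy products multiply the values at `z = 1`. -/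
theorem hasSum_expCoeff {w : ℕ → ℂ} {N : ℕ} (h : ∀ k, N < k → w k = 0) :
    Summable (fun n => ‖expCoeff w n‖) ∧
      HasSum (expCoeff w) (Complex.exp (∑ k ∈ Finset.Icc 1 N, w k / k)) := by
  induction N generalizing w with
  | zero =>
    have h0 : ∀ n, n ∉ ({0} : Finset ℕ) → expCoeff w n = 0 := by
      intro n hn
      obtain ⟨m, rfl⟩ := Nat.exists_eq_succ_of_ne_zero (by simpa using hn)
      rw [← expCoeff_zero_weight (K := ℂ) m]
      exact expCoeff_congr fun k hk _ => h k hk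
    refine ⟨summable_of_ne_finset_zero (s := {0}) fun n hn => by rw [h0 n hn, norm_zero], ?_⟩
    have := hasSum_sum_of_ne_finset_zero (L := SummationFilter.unconditional ℕ) h0
    simpa using this
  | succ N ih =>
    have hw : w = fun k => (if k ≤ N then w k else 0) + if k = N + 1 then w (N + 1) else 0 := by
      funext k
      rcases lt_trichotomy k (N + 1) with hk | hk | hk
      · rw [if_pos (by omega), if_neg (by omega), add_zero]
      · rw [if_neg (by omega), if_pos hk, hk, zero_add]
      · rw [if_neg (by omega), if_neg (by omega), h k hk, add_zero]
    obtain ⟨h1, h1'⟩ := ih (w := fun k => if k ≤ N then w k else 0)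
      fun k hk => if_neg (by omega)
    obtain ⟨h2, h2'⟩ := hasSum_expCoeff_single (w (N + 1)) (k := N + 1) (by omega)
    have hE : expCoeff w = fun n => ∑ i ∈ Finset.range (n + 1),
        expCoeff (fun k => if k ≤ N then w k else 0) i *
          expCoeff (fun k => if k = N + 1 then w (N + 1) else 0) (n - i) := by
      funext n
      rw [← expCoeff_add, ← hw]
    rw [hE]
    refine ⟨summable_norm_sum_mul_range_of_summable_norm h1 h2, ?_⟩
    have h3 := hasSum_sum_range_mul_of_summable_norm h1 h2
    rw [h1'.tsum_eq, h2'.tsum_eq, ← Complex.exp_add] at h3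
    rw [Finset.sum_Icc_succ_top (by omega)]
    have h4 : ∑ k ∈ Finset.Icc 1 N, w k / k =
        ∑ k ∈ Finset.Icc 1 N, (if k ≤ N then w k else 0) / k :=
      Finset.sum_congr rfl fun k hk => by rw [if_pos (Finset.mem_Icc.1 hk).2]
    rw [h4]
    exact h3

theorem hasSum_expCoeff_real {w : ℕ → ℝ} {N : ℕ} (h : ∀ k, N < k → w k = 0) :
    HasSum (expCoeff w) (Real.exp (∑ k ∈ Finset.Icc 1 N, w k / k)) := by
  have h1 := (hasSum_expCoeff (w := fun k => ((w k : ℝ) : ℂ)) (N := N)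
    fun k hk => by rw [h k hk, Complex.ofReal_zero]).2
  rw [← Complex.hasSum_ofReal]
  have h2 : expCoeff (fun k => ((w k : ℝ) : ℂ)) = fun n => ((expCoeff w n : ℝ) : ℂ) :=
    funext (expCoeff_ofReal w)
  rw [h2] at h1
  push_cast
  exact h1

theorem sum_expCoeff_le {w : ℕ → ℝ} {N : ℕ} (h : ∀ k, 1 ≤ k → k ≤ N → 0 ≤ w k) :
    ∑ n ∈ Finset.range (N + 1), expCoeff w n ≤ Real.exp (∑ k ∈ Finset.Icc 1 N, w k / k) := by
  have h1 := hasSum_expCoeff_real (w := fun k => if k ≤ N then w k else 0) (N := N)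
    fun k hk => if_neg (by omega)
  have hnn : ∀ n : ℕ, 0 ≤ expCoeff (fun k => if k ≤ N then w k else 0) n := fun n =>
    expCoeff_nonneg fun k hk _ => by
      split_ifs with hkN
      · exact h k hk hkN
      · exact le_rfl
  have h2 := sum_le_hasSum (Finset.range (N + 1)) (fun n _ => hnn n) h1
  have h3 : ∑ k ∈ Finset.Icc 1 N, w k / k =
      ∑ k ∈ Finset.Icc 1 N, (if k ≤ N then w k else 0) / k :=
    Finset.sum_congr rfl fun k hk => by rw [if_pos (Finset.mem_Icc.1 hk).2]
  have h4 : ∑ n ∈ Finset.range (N + 1), expCoeff w n =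
      ∑ n ∈ Finset.range (N + 1), expCoeff (fun k => if k ≤ N then w k else 0) n :=
    Finset.sum_congr rfl fun n hn => expCoeff_congr fun k _ hk => by
      have := Finset.mem_range.1 hn
      rw [if_pos (by omega)]
  rw [h3, h4]
  exact h2

/-- The Cauchy product with a finitely supported sequence. -/
theorem hasSum_conv_of_support {𝕜 : Type*} [RCLike 𝕜] {b c : ℕ → 𝕜} {N : ℕ} {s : 𝕜}
    (hb : ∀ k, N < k → b k = 0) (hc : Summable fun n => ‖c n‖) (hs : HasSum c s) :
    HasSum (fun m => ∑ i ∈ Finset.range (m + 1), b (i + 1) * c (m - i))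
      ((∑ k ∈ Finset.Icc 1 N, b k) * s) := by
  have hz : ∀ i, i ∉ Finset.range N → b (i + 1) = 0 := fun i hi =>
    hb _ (by simpa [Nat.lt_succ_iff] using hi)
  have h1 : Summable fun i => ‖b (i + 1)‖ :=
    summable_of_ne_finset_zero (s := Finset.range N) fun i hi => by rw [hz i hi, norm_zero]
  have h2 := hasSum_sum_range_mul_of_summable_norm h1 hc
  rw [hs.tsum_eq, (hasSum_sum_of_ne_finset_zero hz).tsum_eq] at h2
  convert h2 using 2
  rw [Finset.range_eq_Ico, Finset.sum_Ico_add' b 0 N 1]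
  rfl

/-- The first moment of the sequence of coefficients. -/
theorem hasSum_mul_expCoeff {w : ℕ → ℝ} {N : ℕ} (h : ∀ k, N < k → w k = 0) :
    HasSum (fun n : ℕ => (n : ℝ) * expCoeff w n)
      ((∑ k ∈ Finset.Icc 1 N, w k) * Real.exp (∑ k ∈ Finset.Icc 1 N, w k / k)) := by
  have h1 := hasSum_expCoeff_real h
  have h2 := hasSum_conv_of_support h h1.summable.norm h1
  rw [← hasSum_nat_add_iff' 1]
  simp only [Finset.range_one, Finset.sum_singleton, Nat.cast_zero, zero_mul, sub_zero]
  have h3 : (fun m => ∑ i ∈ Finset.range (m + 1), w (i + 1) * expCoeff w (m - i)) =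
      fun m : ℕ => ((m + 1 : ℕ) : ℝ) * expCoeff w (m + 1) := by
    funext m
    rw [← succ_mul_expCoeff, Nat.cast_add_one]
  rw [← h3]
  exact h2

end ExpCoeffSum

/-! ### Log-convexity and monotone coefficients. -/

section Kaluza

/-- A variant of Kaluza's theorem: if `v` is positive and log-convex with `v 0 = 1`, then the
nonconstant coefficients of `exp (-∑ v k z ^ k / k)` are nonpositive. -/
theorem expCoeff_neg_nonpos {v : ℕ → ℝ} (h0 : v 0 = 1) (hpos : ∀ k, 0 < v k)
    (hconv : ∀ a b, a ≤ b → v (a + 1) * v b ≤ v a * v (b + 1)) (n : ℕ) :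
    expCoeff (fun k => -v k) (n + 1) ≤ 0 := by
  induction n using Nat.strong_induction_on with
  | _ n ih =>
    set c := expCoeff (fun k => -v k) with hc
    cases n with
    | zero =>
      have := hpos 1
      simp [hc, expCoeff_succ, this.le]
    | succ n =>
      have hc0 : c 0 = 1 := expCoeff_zero _
      have h1 := succ_mul_expCoeff (fun k => -v k) n
      have h2 := succ_mul_expCoeff (fun k => -v k) (n + 1)
      rw [← hc] at h1 h2
      rw [Finset.sum_range_succ, Nat.sub_self, hc0] at h1
      rw [Finset.sum_range_succ, Nat.sub_self, hc0, Finset.sum_range_succ', Nat.sub_zero] at h2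
      have hn := ih n (by omega)
      -- The recurrence for `c (n + 2)` times `v (n + 1)` is compared with the one for `c (n + 1)`
      -- times `v (n + 2)`. Log-convexity handles the interior terms, whose `c (n - k)` are already
      -- nonpositive; the terms `v (n + 1) * v (n + 2)` then cancel.
      have hsum : v (n + 1) * ∑ k ∈ Finset.range n, -v (k + 1 + 1) * c (n + 1 - (k + 1)) ≤
          v (n + 2) * ∑ k ∈ Finset.range n, -v (k + 1) * c (n - k) := by
        rw [Finset.mul_sum, Finset.mul_sum]
        refine Finset.sum_le_sum fun k hk => ?_
        have hk := Finset.mem_range.1 hk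
        have h3 := hconv (k + 1) (n + 1) (by omega)
        have h4 : c (n - k) ≤ 0 := by
          obtain ⟨j, hj⟩ : ∃ j, n - k = j + 1 := ⟨n - k - 1, by omega⟩
          rw [hj]
          exact ih j (by omega)
        rw [show n + 1 - (k + 1) = n - k by omega]
        have h5 := mul_le_mul_of_nonneg_right h3 (neg_nonneg.2 h4)
        linarith
      have hfirst := hconv 0 (n + 1) (by omega)
      rw [h0, one_mul, zero_add] at hfirst
      have h6 := mul_le_mul_of_nonneg_right hfirst (neg_nonneg.2 hn)
      have h7 : v (n + 1) * (((n + 1 : ℕ) : ℝ) + 1) * c (n + 1 + 1) ≤ 0 := by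
        rw [mul_assoc, h2]
        have h8 : v (n + 2) * ((n : ℝ) * c (n + 1)) ≤ 0 :=
          mul_nonpos_of_nonneg_of_nonpos (hpos _).le
            (mul_nonpos_of_nonneg_of_nonpos (Nat.cast_nonneg n) hn)
        have h9 : ∑ k ∈ Finset.range n, -v (k + 1) * c (n - k) =
          ((n : ℝ) + 1) * c (n + 1) + v (n + 1) := by linarith
        rw [h9] at hsum
        rw [zero_add]
        have e : n + 1 + 1 = n + 2 := rfl
        rw [e]
        nlinarith
      have h10 : 0 < v (n + 1) * (((n + 1 : ℕ) : ℝ) + 1) := mul_pos (hpos _) (by positivity)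
      exact nonpos_of_mul_nonpos_right h7 h10

theorem expCoeff_one (n : ℕ) : expCoeff (fun _ => (1 : ℝ)) n = 1 := by
  symm
  exact eq_expCoeff _ (fun _ => (1 : ℝ)) rfl (fun n => by simp) n

/-- The series is `(1 - xz) / (1 - z) = 1 + (1 - x) (z + z² + ...)`. -/
theorem expCoeff_one_sub_pow (x : ℝ) (n : ℕ) : expCoeff (fun k => 1 - x ^ k) (n + 1) = 1 - x := by
  have h := eq_expCoeff (fun k => 1 - x ^ k) (fun n => if n = 0 then 1 else 1 - x) (by simp) ?_
    (n + 1)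
  · simpa using h.symm
  · intro n
    rw [Finset.sum_range_succ]
    have h1 : ∑ i ∈ Finset.range n, (1 - x ^ (i + 1)) * (if n - i = 0 then 1 else 1 - x) =
        ∑ i ∈ Finset.range n, (1 - x ^ (i + 1)) * (1 - x) := by
      refine Finset.sum_congr rfl fun i hi => ?_
      have := Finset.mem_range.1 hi
      rw [if_neg (by omega)]
    have h2 : ∀ m : ℕ, ∑ i ∈ Finset.range m, (1 - x ^ (i + 1)) * (1 - x) =
        m * (1 - x) - (x - x ^ (m + 1)) := by
      intro m
      induction m with
      | zero => simp
      | succ m ihm =>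
        rw [Finset.sum_range_succ, ihm]
        push_cast
        ring
    rw [h1, h2]
    simp
    ring

/-- Since `θ (1 - x^k) = 1 - v k` with `v k = (1 - θ) + θ x^k`, the series is `1 / (1 - z)` times
the exponential with weights `-v`. Its successive differences are therefore coefficients of the
latter, and they are nonpositive because `v` is log-convex. -/
theorem antitone_expCoeff_mul_one_sub_pow {θ x : ℝ} (hθ0 : 0 < θ) (hθ1 : θ ≤ 1) (hx0 : 0 < x)
    (hx1 : x < 1) : Antitone (expCoeff fun k => θ * (1 - x ^ k)) := by
  refine antitone_nat_of_succ_le fun n => ?_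
  set v : ℕ → ℝ := fun k => (1 - θ) + θ * x ^ k with hv
  have hw : (fun k => θ * (1 - x ^ k)) = fun k => -v k + (1 : ℝ) := by
    funext k
    simp only [hv]
    ring
  have hneg := expCoeff_neg_nonpos (v := v) (by simp [hv])
    (fun k => by have := pow_pos hx0 k; simp only [hv]; nlinarith)
    (fun a b hab => by
      have h1 : x ^ b ≤ x ^ a := pow_le_pow_of_le_one hx0.le hx1.le hab
      have h2 : 0 ≤ (1 - θ) * θ * ((x ^ a - x ^ b) * (1 - x)) :=
        mul_nonneg (mul_nonneg (by linarith) hθ0.le)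
          (mul_nonneg (by linarith) (by linarith))
      simp only [hv, pow_succ]
      nlinarith) n
  rw [hw, expCoeff_add, expCoeff_add, Finset.sum_range_succ _ (n + 1)]
  simp only [expCoeff_one, mul_one]
  linarith

end Kaluza

/-! ### Smoothness of coefficients under shifts. -/

section Delay

/-- The sequence `a` delayed by `j` steps. -/
def delay {R : Type*} [Zero R] (j : ℕ) (a : ℕ → R) (N : ℕ) : R :=
  if j ≤ N then a (N - j) else 0

theorem sum_delay_le {r : ℕ → ℝ} (h0 : ∀ N, 0 ≤ r N) (j n : ℕ) :
    ∑ N ∈ Finset.range n, delay j r N ≤ ∑ N ∈ Finset.range n, r N := by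
  have h1 : ∀ m, ∑ N ∈ Finset.range (j + m), delay j r N = ∑ N ∈ Finset.range m, r N := by
    intro m
    rw [Finset.sum_range_add, Finset.sum_eq_zero, zero_add]
    · simp [delay]
    · intro N hN
      rw [delay, if_neg (by simpa using hN)]
  have hnn : ∀ N, 0 ≤ delay j r N := fun N => by
    rw [delay]; split_ifs; exacts [h0 _, le_rfl]
  calc ∑ N ∈ Finset.range n, delay j r N
      ≤ ∑ N ∈ Finset.range (j + n), delay j r N :=
        Finset.sum_le_sum_of_subset_of_nonneg
          (Finset.range_subset_range.2 (by omega)) fun N _ _ => hnn N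
    _ = _ := h1 n

/-- By monotonicity only the first `j` terms have the opposite sign to `delay j r N - r N`;
correcting them costs twice the initial mass, and the signed sum is nonpositive. -/
theorem sum_abs_sub_delay_le {r : ℕ → ℝ} (h0 : ∀ N, 0 ≤ r N) (hr : Antitone r) (j n : ℕ) :
    ∑ N ∈ Finset.range n, |r N - delay j r N| ≤ 2 * ∑ N ∈ Finset.range j, r N := by
  have h1 : ∀ N, |r N - delay j r N| ≤
      (delay j r N - r N) + 2 * (if N < j then r N else 0) := by
    intro N
    rw [delay]
    rcases lt_or_ge N j with h | h
    · rw [if_neg (by omega), if_pos h, sub_zero, abs_of_nonneg (h0 N)]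
      linarith
    · have := hr (Nat.sub_le N j)
      rw [if_pos h, if_neg (by omega), abs_of_nonpos (by linarith)]
      linarith
  have h2 : ∑ N ∈ Finset.range n, (if N < j then r N else 0) ≤ ∑ N ∈ Finset.range j, r N := by
    rw [← Finset.sum_filter]
    refine Finset.sum_le_sum_of_subset_of_nonneg (fun N hN => ?_) fun N _ _ => h0 N
    exact Finset.mem_range.2 (Finset.mem_filter.1 hN).2
  have h3 := sum_delay_le h0 j n
  calc ∑ N ∈ Finset.range n, |r N - delay j r N|
      ≤ ∑ N ∈ Finset.range n, ((delay j r N - r N) + 2 * (if N < j then r N else 0)) :=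
        Finset.sum_le_sum fun N _ => h1 N
    _ = (∑ N ∈ Finset.range n, delay j r N - ∑ N ∈ Finset.range n, r N) +
          2 * ∑ N ∈ Finset.range n, (if N < j then r N else 0) := by
        rw [Finset.sum_add_distrib, Finset.sum_sub_distrib, Finset.mul_sum]
    _ ≤ _ := by linarith

theorem sum_conv_le {e f : ℕ → ℝ} {n : ℕ} (he : ∀ i < n, 0 ≤ e i) (hf : ∀ i < n, 0 ≤ f i) :
    ∑ N ∈ Finset.range n, ∑ i ∈ Finset.range (N + 1), e i * f (N - i) ≤
      (∑ i ∈ Finset.range n, e i) * ∑ i ∈ Finset.range n, f i := by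
  rw [Finset.sum_range_diag_flip n fun i j => e i * f j, Finset.sum_mul]
  refine Finset.sum_le_sum fun i hi => ?_
  rw [← Finset.mul_sum]
  refine mul_le_mul_of_nonneg_left ?_ (he i (Finset.mem_range.1 hi))
  refine Finset.sum_le_sum_of_subset_of_nonneg (Finset.range_subset_range.2 (Nat.sub_le _ _))
    fun j hj _ => hf j (Finset.mem_range.1 hj)

theorem delay_conv (e r : ℕ → ℝ) (j N : ℕ) :
    delay j (fun N => ∑ i ∈ Finset.range (N + 1), e i * r (N - i)) N =
      ∑ i ∈ Finset.range (N + 1), e i * delay j r (N - i) := by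
  unfold delay
  split_ifs with h
  · have hsub : Finset.range (N - j + 1) ⊆ Finset.range (N + 1) :=
      Finset.range_subset_range.2 (by omega)
    rw [← Finset.sum_subset hsub]
    · refine Finset.sum_congr rfl fun i hi => ?_
      have := Finset.mem_range.1 hi
      rw [if_pos (by omega), show N - i - j = N - j - i by omega]
    · intro i hi' hi
      have := Finset.mem_range.not.1 hi
      have := Finset.mem_range.1 hi'
      rw [if_neg (by omega), mul_zero]
  · refine (Finset.sum_eq_zero fun i _ => ?_).symm
    rw [if_neg (by omega), mul_zero]

theorem sum_abs_conv_sub_delay_le {e r : ℕ → ℝ} {n : ℕ} (he : ∀ i < n, 0 ≤ e i)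
    (h0 : ∀ N, 0 ≤ r N) (hr : Antitone r) (j : ℕ) :
    ∑ N ∈ Finset.range n, |(∑ i ∈ Finset.range (N + 1), e i * r (N - i)) -
        delay j (fun N => ∑ i ∈ Finset.range (N + 1), e i * r (N - i)) N| ≤
      (∑ i ∈ Finset.range n, e i) * (2 * ∑ N ∈ Finset.range j, r N) := by
  calc _ ≤ ∑ N ∈ Finset.range n,
        ∑ i ∈ Finset.range (N + 1), e i * |r (N - i) - delay j r (N - i)| := by
        refine Finset.sum_le_sum fun N hN => ?_
        have hN := Finset.mem_range.1 hN
        rw [delay_conv, ← Finset.sum_sub_distrib]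
        refine (Finset.abs_sum_le_sum_abs _ _).trans (Finset.sum_le_sum fun i hi => ?_)
        have hi := Finset.mem_range.1 hi
        rw [← mul_sub, abs_mul, abs_of_nonneg (he i (by omega))]
    _ ≤ _ := sum_conv_le (f := fun N => |r N - delay j r N|) he fun _ _ => abs_nonneg _
    _ ≤ _ := mul_le_mul_of_nonneg_left (sum_abs_sub_delay_le h0 hr j n)
        (Finset.sum_nonneg fun i hi => he i (Finset.mem_range.1 hi))

/-- The coefficients are dominated by those for `θ = 1`, which are `1, 1 - x, 1 - x, ...`. -/
theorem sum_range_expCoeff_one_sub_pow_le {θ x : ℝ} (hθ0 : 0 ≤ θ) (hθ1 : θ ≤ 1) (hx0 : 0 ≤ x)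
    (hx1 : x ≤ 1) (j : ℕ) :
    ∑ N ∈ Finset.range j, expCoeff (fun k => θ * (1 - x ^ k)) N ≤ 1 + j * (1 - x) := by
  have hk : ∀ k, 0 ≤ 1 - x ^ k := fun k => sub_nonneg.2 (pow_le_one₀ hx0 hx1)
  cases j with
  | zero => simp
  | succ j =>
    rw [Finset.sum_range_succ', expCoeff_zero, add_comm]
    refine add_le_add le_rfl ?_
    calc ∑ N ∈ Finset.range j, expCoeff (fun k => θ * (1 - x ^ k)) (N + 1)
        ≤ ∑ N ∈ Finset.range j, (1 - x) := by
          refine Finset.sum_le_sum fun N _ => ?_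
          rw [← expCoeff_one_sub_pow x N]
          exact expCoeff_mono (fun k _ _ => mul_nonneg hθ0 (hk k))
            fun k _ _ => mul_le_of_le_one_left (hk k) hθ1
      _ = j * (1 - x) := by rw [Finset.sum_const, Finset.card_range, nsmul_eq_mul]
      _ ≤ _ := by
          push_cast
          nlinarith

/-- Averaged smoothness of the coefficients of `exp (∑ d k (1 - x ^ k) z ^ k / k)`. -/
theorem sum_abs_expCoeff_sub_delay_le {d : ℕ → ℝ} {n : ℕ} {θ x : ℝ} (hθ0 : 0 < θ) (hθ1 : θ ≤ 1)
    (hx0 : 0 < x) (hx1 : x < 1) (hd : ∀ k, 1 ≤ k → k ≤ n → θ ≤ d k) (j : ℕ) :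
    ∑ N ∈ Finset.range (n + 1), |expCoeff (fun k => d k * (1 - x ^ k)) N -
        delay j (expCoeff fun k => d k * (1 - x ^ k)) N| ≤
      2 * (1 + j * (1 - x)) *
        ∑ N ∈ Finset.range (n + 1), expCoeff (fun k => (d k - θ) * (1 - x ^ k)) N := by
  have hk : ∀ k, 0 ≤ 1 - x ^ k := fun k => sub_nonneg.2 (pow_le_one₀ hx0.le hx1.le)
  -- The weight splits as `(d k - θ) + θ`: the first factor has nonnegative coefficients, the second
  -- decreasing ones.
  have hq : expCoeff (fun k => d k * (1 - x ^ k)) = fun N => ∑ i ∈ Finset.range (N + 1),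
      expCoeff (fun k => (d k - θ) * (1 - x ^ k)) i *
        expCoeff (fun k => θ * (1 - x ^ k)) (N - i) := by
    funext N
    rw [← expCoeff_add]
    refine expCoeff_congr fun k _ _ => ?_
    ring
  have he : ∀ i < n + 1, 0 ≤ expCoeff (fun k => (d k - θ) * (1 - x ^ k)) i := fun i hi =>
    expCoeff_nonneg fun k h1 h2 => mul_nonneg (sub_nonneg.2 (hd k h1 (by omega))) (hk k)
  rw [hq]
  refine (sum_abs_conv_sub_delay_le he
    (fun N => expCoeff_nonneg fun k _ _ => mul_nonneg hθ0.le (hk k))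
    (antitone_expCoeff_mul_one_sub_pow hθ0 hθ1 hx0 hx1) j).trans ?_
  rw [mul_comm]
  refine mul_le_mul_of_nonneg_right ?_
    (Finset.sum_nonneg fun i hi => he i (Finset.mem_range.1 hi))
  exact mul_le_mul_of_nonneg_left
    (sum_range_expCoeff_one_sub_pow_le hθ0.le hθ1 hx0.le hx1.le j) (by norm_num)

end Delay

/-! ### Comparing `q_l` with `p_l / p(x)`. -/

section Evaluation

theorem hasSum_expCoeff_mul_pow {d : ℕ → ℝ} {n : ℕ} (hd : ∀ k, n < k → d k = 0) (x : ℝ) :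
    HasSum (fun j => expCoeff d j * x ^ j)
      (Real.exp (∑ k ∈ Finset.Icc 1 n, d k * x ^ k / k)) := by
  have h := hasSum_expCoeff_real (w := fun k => d k * x ^ k) (N := n)
    fun k hk => by rw [hd k hk, zero_mul]
  rwa [funext (expCoeff_mul_pow d x)] at h

theorem hasSum_mul_expCoeff_mul_pow {d : ℕ → ℝ} {n : ℕ} (hd : ∀ k, n < k → d k = 0) (x : ℝ) :
    HasSum (fun j : ℕ => (j : ℝ) * (expCoeff d j * x ^ j))
      ((∑ k ∈ Finset.Icc 1 n, d k * x ^ k) *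
        Real.exp (∑ k ∈ Finset.Icc 1 n, d k * x ^ k / k)) := by
  have h := hasSum_mul_expCoeff (w := fun k => d k * x ^ k) (N := n)
    fun k hk => by rw [hd k hk, zero_mul]
  simpa only [expCoeff_mul_pow] using h

theorem one_sub_mul_sum_Icc_pow (x : ℝ) (n : ℕ) :
    (1 - x) * ∑ k ∈ Finset.Icc 1 n, x ^ k = x - x ^ (n + 1) := by
  induction n with
  | zero => simp
  | succ n ih =>
    rw [Finset.sum_Icc_succ_top (by omega), mul_add, ih]
    ring

theorem one_sub_mul_sum_mul_pow_le {d : ℕ → ℝ} {n : ℕ} {D x : ℝ} (hD : 0 ≤ D)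
    (hd : ∀ k, 1 ≤ k → k ≤ n → d k ≤ D) (hx0 : 0 ≤ x) (hx1 : x ≤ 1) :
    (1 - x) * ∑ k ∈ Finset.Icc 1 n, d k * x ^ k ≤ D := by
  have h1 : ∑ k ∈ Finset.Icc 1 n, d k * x ^ k ≤ D * ∑ k ∈ Finset.Icc 1 n, x ^ k := by
    rw [Finset.mul_sum]
    refine Finset.sum_le_sum fun k hk => ?_
    have hk := Finset.mem_Icc.1 hk
    exact mul_le_mul_of_nonneg_right (hd k hk.1 hk.2) (by positivity)
  have h2 := one_sub_mul_sum_Icc_pow x n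
  have h3 : 0 ≤ x ^ (n + 1) := by positivity
  calc (1 - x) * ∑ k ∈ Finset.Icc 1 n, d k * x ^ k
      ≤ (1 - x) * (D * ∑ k ∈ Finset.Icc 1 n, x ^ k) :=
        mul_le_mul_of_nonneg_left h1 (by linarith)
    _ = D * (x - x ^ (n + 1)) := by rw [← h2]; ring
    _ ≤ D * 1 := mul_le_mul_of_nonneg_left (by linarith) hD
    _ = D := mul_one D

/-- Minkowski's inequality for finitely many dominated series. -/
theorem sum_norm_le_of_hasSum {ι E : Type*} [NormedAddCommGroup E] [CompleteSpace E]
    {s : Finset ι} {f : ι → ℕ → E} {F : ι → E} (hF : ∀ l ∈ s, HasSum (f l) (F l))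
    {B : ℕ → ℝ} {T : ℝ} (hB : HasSum B T) (h : ∀ j, ∑ l ∈ s, ‖f l j‖ ≤ B j) :
    ∑ l ∈ s, ‖F l‖ ≤ T := by
  have hle : ∀ l ∈ s, ∀ j, ‖f l j‖ ≤ B j := fun l hl j =>
    (Finset.single_le_sum (f := fun l => ‖f l j‖) (fun i _ => norm_nonneg _) hl).trans (h j)
  have hs : ∀ l ∈ s, Summable fun j => ‖f l j‖ := fun l hl =>
    Summable.of_nonneg_of_le (fun _ => norm_nonneg _) (hle l hl) hB.summable
  calc ∑ l ∈ s, ‖F l‖ ≤ ∑ l ∈ s, ∑' j, ‖f l j‖ := Finset.sum_le_sum fun l hl => by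
        rw [← (hF l hl).tsum_eq]
        exact norm_tsum_le_tsum_norm (hs l hl)
    _ = ∑' j, ∑ l ∈ s, ‖f l j‖ := (Summable.tsum_finsetSum hs).symm
    _ ≤ ∑' j, B j := Summable.tsum_le_tsum h (summable_sum hs) hB.summable
    _ = T := hB.tsum_eq

theorem hasSum_mul_delay {c q : ℕ → ℝ} (l : ℕ) :
    HasSum (fun j => c j * delay j q l) (∑ j ∈ Finset.range (l + 1), c j * q (l - j)) := by
  have h : ∀ j, j ∉ Finset.range (l + 1) → c j * delay j q l = 0 := by
    intro j hj
    rw [delay, if_neg (by simpa [Nat.lt_succ_iff] using hj), mul_zero]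
  have h1 : ∑ j ∈ Finset.range (l + 1), c j * delay j q l =
      ∑ j ∈ Finset.range (l + 1), c j * q (l - j) :=
    Finset.sum_congr rfl fun j hj => by
      rw [delay, if_pos (by have := Finset.mem_range.1 hj; omega)]
  rw [← h1]
  exact hasSum_sum_of_ne_finset_zero h

/-- From `p(z) = p(xz) q(z)` one gets `p(x) q_l - p_l = ∑ p_j x^j (q_l - q_{l-j})`. Shift smoothness
costs `1 + j (1 - x)`, and the first moment is harmless because `(1 - x) ∑ d k x^k ≤ D`. -/
theorem sum_abs_mul_expCoeff_sub_le {d : ℕ → ℝ} {n : ℕ} {θ D x : ℝ} (hθ0 : 0 < θ) (hθ1 : θ ≤ 1)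
    (hx0 : 0 < x) (hx1 : x < 1) (hD : 0 ≤ D) (hd : ∀ k, n < k → d k = 0)
    (hdθ : ∀ k, 1 ≤ k → k ≤ n → θ ≤ d k) (hdD : ∀ k, 1 ≤ k → k ≤ n → d k ≤ D) :
    ∑ l ∈ Finset.range (n + 1), |Real.exp (∑ k ∈ Finset.Icc 1 n, d k * x ^ k / k) *
        expCoeff (fun k => d k * (1 - x ^ k)) l - expCoeff d l| ≤
      2 * (1 + D) * Real.exp (∑ k ∈ Finset.Icc 1 n, d k * x ^ k / k) *
        ∑ N ∈ Finset.range (n + 1), expCoeff (fun k => (d k - θ) * (1 - x ^ k)) N := by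
  set A := ∑ N ∈ Finset.range (n + 1), expCoeff (fun k => (d k - θ) * (1 - x ^ k)) N with hA
  set P := Real.exp (∑ k ∈ Finset.Icc 1 n, d k * x ^ k / k) with hP
  set q := expCoeff (fun k => d k * (1 - x ^ k)) with hq
  have hd0 : ∀ k, 1 ≤ k → 0 ≤ d k := fun k hk => by
    rcases le_or_gt k n with h | h
    · exact hθ0.le.trans (hdθ k hk h)
    · rw [hd k h]
  have hA0 : 0 ≤ A := Finset.sum_nonneg fun i hi => expCoeff_nonneg fun k h1 h2 => by
    have := Finset.mem_range.1 hi
    exact mul_nonneg (sub_nonneg.2 (hdθ k h1 (by omega)))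
      (sub_nonneg.2 (pow_le_one₀ hx0.le hx1.le))
  have h1 := hasSum_expCoeff_mul_pow hd x
  have h2 := hasSum_mul_expCoeff_mul_pow hd x
  rw [← hP] at h1 h2
  have hF : ∀ l ∈ Finset.range (n + 1), HasSum
      (fun j => expCoeff d j * x ^ j * (q l - delay j q l)) (P * q l - expCoeff d l) := by
    intro l _
    have h3 := hasSum_mul_delay (c := fun j => expCoeff d j * x ^ j) (q := q) l
    have h4 : ∑ j ∈ Finset.range (l + 1), expCoeff d j * x ^ j * q (l - j) = expCoeff d l := by
      have h5 := expCoeff_add (fun k => d k * x ^ k) (fun k => d k * (1 - x ^ k)) l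
      simp only [expCoeff_mul_pow] at h5
      rw [← h5]
      exact expCoeff_congr fun k _ _ => by ring
    rw [h4] at h3
    simpa only [mul_sub] using (h1.mul_right (q l)).sub h3
  have hB : HasSum (fun j : ℕ => 2 * A * (expCoeff d j * x ^ j +
      (1 - x) * (j * (expCoeff d j * x ^ j))))
      (2 * A * (P + (1 - x) * ((∑ k ∈ Finset.Icc 1 n, d k * x ^ k) * P))) :=
    (h1.add (h2.mul_left (1 - x))).mul_left _
  have h6 := sum_norm_le_of_hasSum hF hB fun j => by
    have hc : 0 ≤ expCoeff d j * x ^ j :=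
      mul_nonneg (expCoeff_nonneg fun k hk _ => hd0 k hk) (by positivity)
    have h7 := mul_le_mul_of_nonneg_left
      (sum_abs_expCoeff_sub_delay_le hθ0 hθ1 hx0 hx1 hdθ j) hc
    rw [← hA, ← hq] at h7
    simp only [norm_mul, Real.norm_eq_abs, ← Finset.mul_sum]
    rw [← abs_mul, abs_of_nonneg hc]
    refine h7.trans (le_of_eq ?_)
    ring
  refine h6.trans ?_
  have h8 := one_sub_mul_sum_mul_pow_le hD hdD hx0.le hx1.le
  have hP0 : 0 < P := Real.exp_pos _
  calc 2 * A * (P + (1 - x) * ((∑ k ∈ Finset.Icc 1 n, d k * x ^ k) * P))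
      = 2 * A * P * (1 + (1 - x) * ∑ k ∈ Finset.Icc 1 n, d k * x ^ k) := by ring
    _ ≤ 2 * A * P * (1 + D) := mul_le_mul_of_nonneg_left (by linarith) (by positivity)
    _ = _ := by ring

end Evaluation

/-! ### The coefficient identity behind the interpolation. -/

section Derivative

/-- The coefficients of `z g'(x z) p(z)` in two forms, where `g = exp (∑ b k z ^ k / k)` and
`p = exp (∑ d k z ^ k / k)`. -/
theorem sum_deriv_coeff {K : Type*} [Field K] [CharZero K] (b d : ℕ → K) (x : K) (l : ℕ) :
    ∑ k ∈ Finset.range (l + 1),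
        (((k : K) + 1) * expCoeff b (k + 1) * x ^ k) * expCoeff d (l - k) =
      ∑ m ∈ Finset.range (l + 1),
        ((∑ i ∈ Finset.range (m + 1), b (i + 1) * expCoeff (fun k => b k + d k) (m - i)) * x ^ m) *
          expCoeff (fun k => d k * (1 - x ^ k)) (l - m) := by
  have hconv : ∀ (u v : ℕ → K) (n : ℕ), PowerSeries.coeff n (PowerSeries.mk u * PowerSeries.mk v) =
      ∑ k ∈ Finset.range (n + 1), u k * v (n - k) := by
    intro u v n
    rw [PowerSeries.coeff_mul, Finset.Nat.sum_antidiagonal_eq_sum_range_succ_mk]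
    simp
  have hpow : ∀ (u v : ℕ → K) (n : ℕ),
      (∑ k ∈ Finset.range (n + 1), u k * v (n - k)) * x ^ n =
        ∑ k ∈ Finset.range (n + 1), (u k * x ^ k) * (v (n - k) * x ^ (n - k)) := by
    intro u v n
    rw [Finset.sum_mul]
    refine Finset.sum_congr rfl fun k hk => ?_
    obtain ⟨j, rfl⟩ := Nat.exists_eq_add_of_le (show k ≤ n by
      have := Finset.mem_range.1 hk; omega)
    rw [Nat.add_sub_cancel_left, pow_add]
    ring
  have h1 : PowerSeries.mk (fun k : ℕ => ((k : K) + 1) * expCoeff b (k + 1) * x ^ k) =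
      PowerSeries.mk (fun k => b (k + 1) * x ^ k) *
        PowerSeries.mk (expCoeff fun k => b k * x ^ k) := by
    ext n
    rw [hconv, PowerSeries.coeff_mk, succ_mul_expCoeff,
      hpow (fun k => b (k + 1)) (expCoeff b)]
    simp only [expCoeff_mul_pow]
  -- The factorization `p(z) = p(xz) q(z)`; the factor `p(xz)` is then merged with `g'(xz)` into
  -- `(g' p)(xz)`.
  have h2 : PowerSeries.mk (expCoeff d) =
      PowerSeries.mk (expCoeff fun k => d k * x ^ k) *
        PowerSeries.mk (expCoeff fun k => d k * (1 - x ^ k)) := by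
    rw [← mk_expCoeff_add]
    congr 2
    funext k
    ring
  have h3 : PowerSeries.mk (expCoeff fun k => b k * x ^ k) *
      PowerSeries.mk (expCoeff fun k => d k * x ^ k) =
        PowerSeries.mk (expCoeff fun k => (b k + d k) * x ^ k) := by
    rw [← mk_expCoeff_add]
    congr 2
    funext k
    ring
  have h4 : PowerSeries.mk (fun m => (∑ i ∈ Finset.range (m + 1),
      b (i + 1) * expCoeff (fun k => b k + d k) (m - i)) * x ^ m) =
        PowerSeries.mk (fun k => b (k + 1) * x ^ k) *
          PowerSeries.mk (expCoeff fun k => (b k + d k) * x ^ k) := by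
    ext n
    rw [hconv, PowerSeries.coeff_mk, hpow (fun k => b (k + 1))]
    simp only [expCoeff_mul_pow]
  rw [← hconv, ← hconv, h1, h2, h4, ← h3]
  simp only [mul_assoc]

end Derivative

/-! ### The path `g(xz) p(z)` and the value path `g(x)`. -/

section Interpolation

/-- The coefficients of `g(x z) p(z)` with `g = exp (∑ b k z ^ k / k)`, `p = exp (∑ d k z ^ k / k)`.
They interpolate between the coefficients of `p` and those of `g p`. -/
noncomputable def interp (b : ℕ → ℂ) (d : ℕ → ℝ) (l : ℕ) (x : ℝ) : ℂ :=
  ∑ k ∈ Finset.range (l + 1), expCoeff b k * (x : ℂ) ^ k * ((expCoeff d (l - k) : ℝ) : ℂ)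

/-- The coefficients of `z g'(z) p(z)`, shifted by one. -/
noncomputable def logDerivCoeff (b : ℕ → ℂ) (d : ℕ → ℝ) (m : ℕ) : ℂ :=
  ∑ i ∈ Finset.range (m + 1), b (i + 1) * expCoeff (fun k => b k + (d k : ℂ)) (m - i)

/-- The derivative of `interp b d l`. -/
noncomputable def interpDeriv (b : ℕ → ℂ) (d : ℕ → ℝ) (l : ℕ) (x : ℝ) : ℂ :=
  ∑ m ∈ Finset.range l, logDerivCoeff b d m * (x : ℂ) ^ m *
    ((expCoeff (fun k => d k * (1 - x ^ k)) (l - 1 - m) : ℝ) : ℂ)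

theorem interp_zero (b : ℕ → ℂ) (d : ℕ → ℝ) (l : ℕ) : interp b d l 0 = ((expCoeff d l : ℝ) : ℂ) := by
  rw [interp, Finset.sum_range_succ']
  simp

theorem interp_one (b : ℕ → ℂ) (d : ℕ → ℝ) (l : ℕ) :
    interp b d l 1 = expCoeff (fun k => b k + (d k : ℂ)) l := by
  rw [interp, expCoeff_add b fun k => (d k : ℂ)]
  simp [expCoeff_ofReal]

theorem hasDerivAt_interp (b : ℕ → ℂ) (d : ℕ → ℝ) (l : ℕ) (x : ℝ) :
    HasDerivAt (interp b d l) (interpDeriv b d l x) x := by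
  have hpow : ∀ k : ℕ, HasDerivAt (fun y : ℝ => (y : ℂ) ^ k) ((k : ℂ) * (x : ℂ) ^ (k - 1)) x :=
    fun k => by simpa using (hasDerivAt_pow k (x : ℂ)).comp_ofReal
  have h1 : HasDerivAt (interp b d l) (∑ k ∈ Finset.range (l + 1),
      expCoeff b k * ((k : ℂ) * (x : ℂ) ^ (k - 1)) * ((expCoeff d (l - k) : ℝ) : ℂ)) x :=
    HasDerivAt.fun_sum fun k _ => ((hpow k).const_mul _).mul_const _
  convert h1 using 1
  cases l with
  | zero => simp [interpDeriv]
  | succ l =>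
    rw [Finset.sum_range_succ', interpDeriv]
    have h2 := sum_deriv_coeff b (fun k => (d k : ℂ)) (x : ℂ) l
    have h3 : expCoeff (fun k => (d k : ℂ) * (1 - (x : ℂ) ^ k)) =
        fun n => ((expCoeff (fun k => d k * (1 - x ^ k)) n : ℝ) : ℂ) := by
      funext n
      rw [← expCoeff_ofReal]
      push_cast
      rfl
    rw [h3] at h2
    simp only [expCoeff_ofReal] at h2
    simp only [logDerivCoeff, Nat.add_sub_cancel]
    rw [← h2]
    simp only [Nat.cast_zero, zero_mul, mul_zero, add_zero, Nat.add_sub_add_right]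
    refine Finset.sum_congr rfl fun k _ => ?_
    push_cast
    ring

theorem continuous_interpDeriv (b : ℕ → ℂ) (d : ℕ → ℝ) (l : ℕ) :
    Continuous (interpDeriv b d l) := by
  have hexp : ∀ n : ℕ, Continuous fun x : ℝ => expCoeff (fun k => d k * (1 - x ^ k)) n := by
    intro n
    induction n using Nat.strong_induction_on with
    | _ n ih =>
      cases n with
      | zero => simpa using continuous_const
      | succ n =>
        simp only [expCoeff_succ]
        refine (continuous_finsetSum _ fun i _ => ?_).div_const _
        exact (by fun_prop : Continuous fun x : ℝ => d (i + 1) * (1 - x ^ (i + 1))).mul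
          (ih _ (by omega))
  unfold interpDeriv
  refine continuous_finsetSum _ fun m _ => ?_
  exact (by fun_prop : Continuous fun x : ℝ => logDerivCoeff b d m * (x : ℂ) ^ m).mul
    (Complex.continuous_ofReal.comp (hexp _))

theorem norm_logDerivCoeff_le {b : ℕ → ℂ} {d ε : ℕ → ℝ} {D : ℝ}
    (hb : ∀ k, 1 ≤ k → ‖b k‖ ≤ D * ε k) (hbd : ∀ k, 1 ≤ k → ‖b k + (d k : ℂ)‖ ≤ d k) (m : ℕ) :
    ‖logDerivCoeff b d m‖ ≤
      D * ∑ i ∈ Finset.range (m + 1), ε (i + 1) * expCoeff d (m - i) := by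
  rw [logDerivCoeff, Finset.mul_sum]
  refine (norm_sum_le _ _).trans (Finset.sum_le_sum fun i _ => ?_)
  rw [norm_mul, ← mul_assoc]
  exact mul_le_mul (hb _ (by omega)) (norm_expCoeff_le fun k hk _ => hbd k hk) (norm_nonneg _)
    ((norm_nonneg _).trans (hb (i + 1) (by omega)))

/-- The function `exp (∑ b k x ^ k / k)` on the real line. -/
noncomputable def expPoly (b : ℕ → ℂ) (n : ℕ) (x : ℝ) : ℂ :=
  Complex.exp (∑ k ∈ Finset.Icc 1 n, b k * (x : ℂ) ^ k / k)

theorem hasDerivAt_expPoly (b : ℕ → ℂ) (n : ℕ) (x : ℝ) :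
    HasDerivAt (expPoly b n)
      ((∑ k ∈ Finset.Icc 1 n, b k * (x : ℂ) ^ (k - 1)) * expPoly b n x) x := by
  have hpow : ∀ k : ℕ, HasDerivAt (fun y : ℝ => (y : ℂ) ^ k) ((k : ℂ) * (x : ℂ) ^ (k - 1)) x :=
    fun k => by simpa using (hasDerivAt_pow k (x : ℂ)).comp_ofReal
  have h1 : HasDerivAt (fun y : ℝ => ∑ k ∈ Finset.Icc 1 n, b k * (y : ℂ) ^ k / k)
      (∑ k ∈ Finset.Icc 1 n, b k * ((k : ℂ) * (x : ℂ) ^ (k - 1)) / k) x :=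
    HasDerivAt.fun_sum fun k _ => ((hpow k).const_mul _).div_const _
  have h2 : ∑ k ∈ Finset.Icc 1 n, b k * ((k : ℂ) * (x : ℂ) ^ (k - 1)) / k =
      ∑ k ∈ Finset.Icc 1 n, b k * (x : ℂ) ^ (k - 1) :=
    Finset.sum_congr rfl fun k hk => by
      have : (k : ℂ) ≠ 0 := Nat.cast_ne_zero.2 (by have := Finset.mem_Icc.1 hk; omega)
      field_simp
  rw [h2] at h1
  have h3 := h1.cexp
  rwa [mul_comm] at h3

theorem continuous_expPoly (b : ℕ → ℂ) (n : ℕ) : Continuous (expPoly b n) := by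
  unfold expPoly
  fun_prop

theorem conv_mul_pow {R : Type*} [CommSemiring R] (u v : ℕ → R) (x : R) (m : ℕ) :
    (∑ i ∈ Finset.range (m + 1), u (i + 1) * v (m - i)) * x ^ m =
      ∑ i ∈ Finset.range (m + 1), (u (i + 1) * x ^ (i + 1 - 1)) * (v (m - i) * x ^ (m - i)) := by
  rw [Finset.sum_mul]
  refine Finset.sum_congr rfl fun i hi => ?_
  obtain ⟨j, rfl⟩ := Nat.exists_eq_add_of_le (show i ≤ m by
    have := Finset.mem_range.1 hi; omega)
  rw [Nat.add_sub_cancel_left, Nat.add_sub_cancel, pow_add]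
  ring

theorem hasSum_logDerivCoeff {b : ℕ → ℂ} {d : ℕ → ℝ} {n : ℕ} (hb : ∀ k, n < k → b k = 0)
    (hd : ∀ k, n < k → d k = 0) (x : ℝ) :
    HasSum (fun m => logDerivCoeff b d m * (x : ℂ) ^ m)
      ((∑ k ∈ Finset.Icc 1 n, b k * (x : ℂ) ^ (k - 1)) * (expPoly b n x *
        (Real.exp (∑ k ∈ Finset.Icc 1 n, d k * x ^ k / k) : ℂ))) := by
  obtain ⟨h1, h2⟩ := hasSum_expCoeff (w := fun k => (b k + (d k : ℂ)) * (x : ℂ) ^ k) (N := n)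
    fun k hk => by simp [hb k hk, hd k hk]
  have h3 := hasSum_conv_of_support (b := fun k => b k * (x : ℂ) ^ (k - 1)) (N := n)
    (fun k hk => by rw [hb k hk, zero_mul]) h1 h2
  have h4 : Complex.exp (∑ k ∈ Finset.Icc 1 n, (b k + (d k : ℂ)) * (x : ℂ) ^ k / k) =
      expPoly b n x * (Real.exp (∑ k ∈ Finset.Icc 1 n, d k * x ^ k / k) : ℂ) := by
    rw [expPoly, Complex.ofReal_exp, ← Complex.exp_add]
    congr 1
    push_cast
    rw [← Finset.sum_add_distrib]
    exact Finset.sum_congr rfl fun k _ => by ring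
  rw [h4] at h3
  have h5 : (fun m => logDerivCoeff b d m * (x : ℂ) ^ m) = fun m =>
      ∑ i ∈ Finset.range (m + 1), b (i + 1) * (x : ℂ) ^ (i + 1 - 1) *
        expCoeff (fun k => (b k + (d k : ℂ)) * (x : ℂ) ^ k) (m - i) := by
    funext m
    simp only [expCoeff_mul_pow]
    exact conv_mul_pow b (expCoeff fun k => b k + (d k : ℂ)) (x : ℂ) m
  rw [h5]
  exact h3

/-- The convolution majorizes the coefficients of `g' p` up to the factor `D`. The moment with
weight `m + 1` is needed since a shift by `m + 1` costs `1 + (m + 1)(1 - x)`; it splits as `(i + 1)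
+ (m - i)`. -/
theorem hasSum_conv_moments {d ε : ℕ → ℝ} {n : ℕ} (hε : ∀ k, n < k → ε k = 0)
    (hd : ∀ k, n < k → d k = 0) (x : ℝ) :
    HasSum (fun m => (∑ i ∈ Finset.range (m + 1), ε (i + 1) * expCoeff d (m - i)) * x ^ m)
      ((∑ k ∈ Finset.Icc 1 n, ε k * x ^ (k - 1)) *
        Real.exp (∑ k ∈ Finset.Icc 1 n, d k * x ^ k / k)) ∧
    HasSum (fun m : ℕ => ((m : ℝ) + 1) *
        ((∑ i ∈ Finset.range (m + 1), ε (i + 1) * expCoeff d (m - i)) * x ^ m))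
      ((∑ k ∈ Finset.Icc 1 n, k * (ε k * x ^ (k - 1))) *
          Real.exp (∑ k ∈ Finset.Icc 1 n, d k * x ^ k / k) +
        (∑ k ∈ Finset.Icc 1 n, ε k * x ^ (k - 1)) * ((∑ k ∈ Finset.Icc 1 n, d k * x ^ k) *
          Real.exp (∑ k ∈ Finset.Icc 1 n, d k * x ^ k / k))) := by
  have h1 := hasSum_expCoeff_mul_pow hd x
  have h2 := hasSum_mul_expCoeff_mul_pow hd x
  have hb : ∀ k, n < k → ε k * x ^ (k - 1) = 0 := fun k hk => by rw [hε k hk, zero_mul]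
  have hb' : ∀ k : ℕ, n < k → (k : ℝ) * (ε k * x ^ (k - 1)) = 0 := fun k hk => by
    rw [hb k hk, mul_zero]
  constructor
  · have h3 := hasSum_conv_of_support hb h1.summable.norm h1
    rw [funext (conv_mul_pow ε (expCoeff d) x)]
    exact h3
  · have h4 := (hasSum_conv_of_support hb' h1.summable.norm h1).add
      (hasSum_conv_of_support hb h2.summable.norm h2)
    have h5 : (fun m : ℕ => ((m : ℝ) + 1) *
        ((∑ i ∈ Finset.range (m + 1), ε (i + 1) * expCoeff d (m - i)) * x ^ m)) = fun m : ℕ =>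
        (∑ i ∈ Finset.range (m + 1), ((i + 1 : ℕ) : ℝ) * (ε (i + 1) * x ^ (i + 1 - 1)) *
          (expCoeff d (m - i) * x ^ (m - i))) +
        ∑ i ∈ Finset.range (m + 1), ε (i + 1) * x ^ (i + 1 - 1) *
          (((m - i : ℕ) : ℝ) * (expCoeff d (m - i) * x ^ (m - i))) := by
      funext m
      rw [conv_mul_pow, Finset.mul_sum, ← Finset.sum_add_distrib]
      refine Finset.sum_congr rfl fun i hi => ?_
      rw [Nat.cast_sub (by have := Finset.mem_range.1 hi; omega)]
      push_cast
      ring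
    rw [h5]
    exact h4

end Interpolation

/-! ### Growth of the partial sums of `p_j`. -/

section PartialSums

/-- A discrete Grönwall inequality: beyond `n`, each new term is at most `D / n` times the preceding
partial sum. -/
theorem le_sum_range_of_le {p : ℕ → ℝ} {D : ℝ} {n : ℕ} (hn : 1 ≤ n) (hD : 0 ≤ D)
    (hp : ∀ j, 0 ≤ p j) (h : ∀ j : ℕ, (j : ℝ) * p j ≤ D * ∑ i ∈ Finset.range j, p i) (i : ℕ) :
    ∑ j ∈ Finset.range (n + i), p j ≤ (1 + D / n) ^ i * ∑ j ∈ Finset.range n, p j := by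
  induction i with
  | zero => simp
  | succ i ih =>
    have hn0 : (0 : ℝ) < n := by exact_mod_cast hn
    have hQ : 0 ≤ ∑ j ∈ Finset.range (n + i), p j := Finset.sum_nonneg fun j _ => hp j
    have h1 : p (n + i) ≤ D / n * ∑ j ∈ Finset.range (n + i), p j := by
      rw [div_mul_eq_mul_div, le_div_iff₀ hn0]
      refine le_trans ?_ (h (n + i))
      rw [mul_comm]
      exact mul_le_mul_of_nonneg_right (by push_cast; linarith [(Nat.cast_nonneg i : (0 : ℝ) ≤ i)])
        (hp _)
    rw [← add_assoc, Finset.sum_range_succ]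
    calc _ ≤ (1 + D / n) * ∑ j ∈ Finset.range (n + i), p j := by linarith
      _ ≤ (1 + D / n) * ((1 + D / n) ^ i * ∑ j ∈ Finset.range n, p j) :=
        mul_le_mul_of_nonneg_left ih (by positivity)
      _ = _ := by ring

theorem mul_expCoeff_le {d : ℕ → ℝ} {D : ℝ} (hd0 : ∀ k, 1 ≤ k → 0 ≤ d k)
    (hdD : ∀ k, 1 ≤ k → d k ≤ D) (j : ℕ) :
    (j : ℝ) * expCoeff d j ≤ D * ∑ i ∈ Finset.range j, expCoeff d i := by
  cases j with
  | zero => simp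
  | succ j =>
    rw [Nat.cast_add_one, succ_mul_expCoeff, ← Finset.sum_range_reflect (fun i => expCoeff d i),
      Finset.mul_sum]
    refine Finset.sum_le_sum fun i _ => ?_
    rw [Nat.add_sub_cancel]
    exact mul_le_mul_of_nonneg_right (hdD _ (by omega))
      (expCoeff_nonneg fun k hk _ => hd0 k hk)

/-- The partial sums of the coefficients are at least of the expected order. -/
theorem exp_le_mul_sum_expCoeff {d : ℕ → ℝ} {D : ℝ} {n : ℕ} (hn : 1 ≤ n) (hD : 0 ≤ D)
    (hd : ∀ k, n < k → d k = 0) (hd0 : ∀ k, 1 ≤ k → 0 ≤ d k) (hdD : ∀ k, 1 ≤ k → d k ≤ D) :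
    Real.exp (∑ k ∈ Finset.Icc 1 n, d k / k) ≤
      2 * Real.exp (D * (⌈2 * D⌉₊ + 1)) * ∑ j ∈ Finset.range (n + 1), expCoeff d j := by
  set E := Real.exp (∑ k ∈ Finset.Icc 1 n, d k / k) with hE
  -- With `K ≥ 2 D`, Markov's inequality leaves at most half of the total mass `E` at indices `≥ K
  -- n`, as the first moment is at most `n D E`. The extra `1` keeps `K` positive when `D = 0`.
  set K : ℕ := ⌈2 * D⌉₊ + 1 with hK
  have hK2 : 2 * D ≤ K := by
    have := Nat.le_ceil (2 * D)
    rw [hK]; push_cast; linarith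
  have hp : ∀ j, 0 ≤ expCoeff d j := fun j => expCoeff_nonneg fun k hk _ => hd0 k hk
  have hn0 : (0 : ℝ) < n := by exact_mod_cast hn
  have hK0 : (0 : ℝ) < K := by rw [hK]; positivity
  have h1 := hasSum_expCoeff_real hd
  have h2 := hasSum_mul_expCoeff hd
  rw [← hE] at h1 h2
  have hE0 : 0 < E := Real.exp_pos _
  have h3 : HasSum (fun j => if j < K * n then expCoeff d j else 0)
      (∑ j ∈ Finset.range (K * n), expCoeff d j) := by
    have h4 : ∑ j ∈ Finset.range (K * n), (if j < K * n then expCoeff d j else 0) =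
        ∑ j ∈ Finset.range (K * n), expCoeff d j :=
      Finset.sum_congr rfl fun j hj => by rw [if_pos (Finset.mem_range.1 hj)]
    rw [← h4]
    exact hasSum_sum_of_ne_finset_zero fun j hj => if_neg (by simpa using hj)
  have h5 := hasSum_le (fun j => ?_) h1 (h3.add (h2.mul_left (1 / ((K : ℝ) * n))))
  · have h6 : ∑ k ∈ Finset.Icc 1 n, d k ≤ n * D := by
      have := Finset.sum_le_card_nsmul (Finset.Icc 1 n) d D
        fun k hk => hdD k (Finset.mem_Icc.1 hk).1
      simpa using this
    have h7 : 1 / ((K : ℝ) * n) * ((∑ k ∈ Finset.Icc 1 n, d k) * E) ≤ E / 2 := by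
      rw [div_mul_eq_mul_div, one_mul, div_le_iff₀ (by positivity)]
      calc (∑ k ∈ Finset.Icc 1 n, d k) * E ≤ (n * D) * E :=
            mul_le_mul_of_nonneg_right h6 hE0.le
        _ = E / 2 * (2 * D * n) := by ring
        _ ≤ E / 2 * (K * n) := by gcongr
    have h8 : E ≤ 2 * ∑ j ∈ Finset.range (K * n), expCoeff d j := by linarith
    have h9 := le_sum_range_of_le hn hD hp (mul_expCoeff_le hd0 hdD) (K * n)
    have h10 : (1 + D / n) ^ (K * n) ≤ Real.exp (D * K) := by
      calc (1 + D / n) ^ (K * n) ≤ Real.exp (D / n) ^ (K * n) := by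
            gcongr
            rw [add_comm]
            exact Real.add_one_le_exp _
        _ = Real.exp (D * K) := by
            rw [← Real.exp_nat_mul]
            congr 1
            push_cast
            field_simp
    have h11 : ∑ j ∈ Finset.range (K * n), expCoeff d j ≤
        ∑ j ∈ Finset.range (n + K * n), expCoeff d j :=
      Finset.sum_le_sum_of_subset_of_nonneg (Finset.range_subset_range.2 (by omega))
        fun j _ _ => hp j
    have h12 : ∑ j ∈ Finset.range n, expCoeff d j ≤ ∑ j ∈ Finset.range (n + 1), expCoeff d j :=
      Finset.sum_le_sum_of_subset_of_nonneg (Finset.range_subset_range.2 (by omega))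
        fun j _ _ => hp j
    have h13 : (1 + D / n) ^ (K * n) * ∑ j ∈ Finset.range n, expCoeff d j ≤
        Real.exp (D * K) * ∑ j ∈ Finset.range (n + 1), expCoeff d j :=
      mul_le_mul h10 h12 (Finset.sum_nonneg fun j _ => hp j) (Real.exp_pos _).le
    have hKc : ((⌈2 * D⌉₊ : ℝ) + 1) = K := by rw [hK]; push_cast; rfl
    rw [hKc]
    linarith
  · have hj0 : 0 ≤ 1 / ((K : ℝ) * n) * (j * expCoeff d j) := by
      have := hp j
      positivity
    split_ifs with hj
    · linarith
    · rw [zero_add, div_mul_eq_mul_div, one_mul, le_div_iff₀ (by positivity), mul_comm]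
      refine mul_le_mul_of_nonneg_right ?_ (hp j)
      exact_mod_cast not_lt.1 hj

/-- The harmonic sum is at least `log n`, and the truncated series of `-log (1 - x)` is at most its
full value. -/
theorem log_le_sum_one_sub_pow_div {n : ℕ} (hn : 1 ≤ n) {x : ℝ} (hx0 : 0 ≤ x) (hx1 : x < 1) :
    Real.log (n * (1 - x)) ≤ ∑ k ∈ Finset.Icc 1 n, (1 - x ^ k) / k := by
  have hn0 : (0 : ℝ) < n := by exact_mod_cast hn
  have h1 : Real.log n ≤ ∑ k ∈ Finset.Icc 1 n, (1 : ℝ) / k := by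
    have h := log_add_one_le_harmonic n
    have h2 : Real.log n ≤ Real.log (n + 1 : ℕ) :=
      Real.log_le_log hn0 (by push_cast; linarith)
    rw [harmonic_eq_sum_Icc] at h
    push_cast at h h2
    simp only [one_div]
    linarith
  have h2 : ∑ k ∈ Finset.Icc 1 n, x ^ k / k ≤ -Real.log (1 - x) := by
    have h := Real.hasSum_pow_div_log_of_abs_lt_one (x := x) (by rwa [abs_of_nonneg hx0])
    have h3 := sum_le_hasSum (Finset.range n) (fun i _ => by positivity) h
    have h4 := Finset.sum_Ico_add' (fun k : ℕ => x ^ k / (k : ℝ)) 0 n 1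
    rw [← Finset.range_eq_Ico] at h4
    push_cast at h4
    exact h4.symm.trans_le h3
  rw [Real.log_mul hn0.ne' (by linarith)]
  simp only [sub_div, Finset.sum_sub_distrib]
  linarith

/-- Bounding the sum by the value at `z = 1`, the exponents combine to `∑ d k / k - θ ∑ (1 - x^k) /
k`. The first part is comparable to the partial sum of the `p_j`, the second produces the power of
`n (1 - x)`. -/
theorem sum_expCoeff_sub_mul_exp_le {d : ℕ → ℝ} {θ D x : ℝ} {n : ℕ} (hn : 1 ≤ n) (hθ : 0 < θ)
    (hx0 : 0 < x) (hx1 : x < 1) (hD : 0 ≤ D) (hd : ∀ k, n < k → d k = 0)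
    (hdθ : ∀ k, 1 ≤ k → k ≤ n → θ ≤ d k) (hdD : ∀ k, 1 ≤ k → k ≤ n → d k ≤ D) :
    (∑ N ∈ Finset.range (n + 1), expCoeff (fun k => (d k - θ) * (1 - x ^ k)) N) *
        Real.exp (∑ k ∈ Finset.Icc 1 n, d k * x ^ k / k) ≤
      2 * Real.exp (D * (⌈2 * D⌉₊ + 1)) * (∑ j ∈ Finset.range (n + 1), expCoeff d j) *
        (n * (1 - x)) ^ (-θ) := by
  have hn0 : (0 : ℝ) < n := by exact_mod_cast hn
  have hd0 : ∀ k, 1 ≤ k → 0 ≤ d k := fun k hk => by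
    rcases le_or_gt k n with h | h
    · exact hθ.le.trans (hdθ k hk h)
    · rw [hd k h]
  have hdD' : ∀ k, 1 ≤ k → d k ≤ D := fun k hk => by
    rcases le_or_gt k n with h | h
    · exact hdD k hk h
    · rw [hd k h]
      exact hD
  have h1 := sum_expCoeff_le (w := fun k => (d k - θ) * (1 - x ^ k)) (N := n)
    fun k hk hkn => mul_nonneg (sub_nonneg.2 (hdθ k hk hkn))
      (sub_nonneg.2 (pow_le_one₀ hx0.le hx1.le))
  have h2 := exp_le_mul_sum_expCoeff hn hD hd hd0 hdD'
  have h3 := log_le_sum_one_sub_pow_div hn hx0.le hx1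
  have h4 : ∑ k ∈ Finset.Icc 1 n, (d k - θ) * (1 - x ^ k) / k +
      ∑ k ∈ Finset.Icc 1 n, d k * x ^ k / k =
        ∑ k ∈ Finset.Icc 1 n, d k / k - θ * ∑ k ∈ Finset.Icc 1 n, (1 - x ^ k) / k := by
    rw [Finset.mul_sum, ← Finset.sum_add_distrib, ← Finset.sum_sub_distrib]
    exact Finset.sum_congr rfl fun k _ => by ring
  calc _ ≤ Real.exp (∑ k ∈ Finset.Icc 1 n, (d k - θ) * (1 - x ^ k) / k) *
        Real.exp (∑ k ∈ Finset.Icc 1 n, d k * x ^ k / k) :=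
        mul_le_mul_of_nonneg_right h1 (Real.exp_pos _).le
    _ = Real.exp (∑ k ∈ Finset.Icc 1 n, d k / k) *
        Real.exp (-(θ * ∑ k ∈ Finset.Icc 1 n, (1 - x ^ k) / k)) := by
        rw [← Real.exp_add, h4, sub_eq_add_neg, Real.exp_add]
    _ ≤ _ := by
        refine mul_le_mul h2 ?_ (Real.exp_pos _).le ((Real.exp_pos _).le.trans h2)
        rw [Real.rpow_def_of_pos (mul_pos hn0 (by linarith)), Real.exp_le_exp]
        have := mul_le_mul_of_nonneg_left h3 hθ.le
        linarith

end PartialSums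

/-! ### Bounds in `ℓ¹` for the derivative of the path. -/

section DerivativeBounds

/-- The difference is `∑ S_m x^m (q_{l-1-m} - p_l / p(x))`. Passing through `q_l`, the sum over `l`
is bounded by shift smoothness plus `sum_abs_mul_expCoeff_sub_le`, and the sum over `m` by the two
moments. -/
theorem sum_norm_interpDeriv_sub_le {b : ℕ → ℂ} {d ε : ℕ → ℝ} {n : ℕ} {θ D x : ℝ} (hθ0 : 0 < θ)
    (hθ1 : θ ≤ 1) (hx0 : 0 < x) (hx1 : x < 1) (hD : 0 ≤ D) (hd : ∀ k, n < k → d k = 0)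
    (hdθ : ∀ k, 1 ≤ k → k ≤ n → θ ≤ d k) (hdD : ∀ k, 1 ≤ k → k ≤ n → d k ≤ D)
    (hε : ∀ k, n < k → ε k = 0) (hε0 : ∀ k, 0 ≤ ε k) (hbn : ∀ k, n < k → b k = 0)
    (hb : ∀ k, 1 ≤ k → ‖b k‖ ≤ D * ε k) (hbd : ∀ k, 1 ≤ k → ‖b k + (d k : ℂ)‖ ≤ d k) :
    ∑ l ∈ Finset.range (n + 1), ‖interpDeriv b d l x - ((expCoeff d l : ℝ) : ℂ) *
        ((∑ k ∈ Finset.Icc 1 n, b k * (x : ℂ) ^ (k - 1)) * expPoly b n x)‖ ≤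
      2 * D * ((∑ N ∈ Finset.range (n + 1), expCoeff (fun k => (d k - θ) * (1 - x ^ k)) N) *
        Real.exp (∑ k ∈ Finset.Icc 1 n, d k * x ^ k / k)) *
        ∑ k ∈ Finset.Icc 1 n, ε k * (x ^ (k - 1) * (2 + 2 * D + k * (1 - x))) := by
  set A := ∑ N ∈ Finset.range (n + 1), expCoeff (fun k => (d k - θ) * (1 - x ^ k)) N with hA
  set P := Real.exp (∑ k ∈ Finset.Icc 1 n, d k * x ^ k / k) with hP
  set q := expCoeff (fun k => d k * (1 - x ^ k)) with hq
  set σ : ℕ → ℝ := fun m => ∑ i ∈ Finset.range (m + 1), ε (i + 1) * expCoeff d (m - i) with hσ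
  have hP0 : 0 < P := Real.exp_pos _
  have hA0 : 0 ≤ A := Finset.sum_nonneg fun i hi => expCoeff_nonneg fun k h1 h2 => by
    have := Finset.mem_range.1 hi
    exact mul_nonneg (sub_nonneg.2 (hdθ k h1 (by omega)))
      (sub_nonneg.2 (pow_le_one₀ hx0.le hx1.le))
  have hS : ∀ m, ‖logDerivCoeff b d m‖ ≤ D * σ m := norm_logDerivCoeff_le hb hbd
  have hF : ∀ l ∈ Finset.range (n + 1), HasSum
      (fun m => logDerivCoeff b d m * (x : ℂ) ^ m *
        ((delay (m + 1) q l - expCoeff d l / P : ℝ) : ℂ))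
      (interpDeriv b d l x - ((expCoeff d l : ℝ) : ℂ) *
        ((∑ k ∈ Finset.Icc 1 n, b k * (x : ℂ) ^ (k - 1)) * expPoly b n x)) := by
    intro l _
    have h1 : HasSum (fun m => logDerivCoeff b d m * (x : ℂ) ^ m *
        ((delay (m + 1) q l : ℝ) : ℂ)) (interpDeriv b d l x) := by
      have h2 : ∀ m, m ∉ Finset.range l → logDerivCoeff b d m * (x : ℂ) ^ m *
          ((delay (m + 1) q l : ℝ) : ℂ) = 0 := by
        intro m hm
        rw [delay, if_neg (by have := Finset.mem_range.not.1 hm; omega), Complex.ofReal_zero,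
          mul_zero]
      have h3 : interpDeriv b d l x = ∑ m ∈ Finset.range l, logDerivCoeff b d m * (x : ℂ) ^ m *
          ((delay (m + 1) q l : ℝ) : ℂ) := by
        refine Finset.sum_congr rfl fun m hm => ?_
        rw [delay, if_pos (by have := Finset.mem_range.1 hm; omega), hq,
          show l - (m + 1) = l - 1 - m by omega]
      rw [h3]
      exact hasSum_sum_of_ne_finset_zero h2
    have h4 := (hasSum_logDerivCoeff hbn hd x).mul_right ((expCoeff d l / P : ℝ) : ℂ)
    rw [← hP] at h4
    have hPc : (P : ℂ) ≠ 0 := Complex.ofReal_ne_zero.2 hP0.ne'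
    have h5 : (∑ k ∈ Finset.Icc 1 n, b k * (x : ℂ) ^ (k - 1)) * (expPoly b n x * (P : ℂ)) *
        ((expCoeff d l / P : ℝ) : ℂ) = ((expCoeff d l : ℝ) : ℂ) *
        ((∑ k ∈ Finset.Icc 1 n, b k * (x : ℂ) ^ (k - 1)) * expPoly b n x) := by
      push_cast
      field_simp
    rw [h5] at h4
    have h6 := h1.sub h4
    simp only [← mul_sub, ← Complex.ofReal_sub] at h6
    exact h6
  obtain ⟨hm0, hm1⟩ := hasSum_conv_moments hε hd x
  rw [← hP] at hm0 hm1
  have hB := ((hm0.mul_left (2 + D)).add (hm1.mul_left (1 - x))).mul_left (2 * A * D)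
  refine (sum_norm_le_of_hasSum hF hB fun m => ?_).trans ?_
  · have h1 := sum_abs_expCoeff_sub_delay_le hθ0 hθ1 hx0 hx1 hdθ (m + 1)
    have h2 := sum_abs_mul_expCoeff_sub_le hθ0 hθ1 hx0 hx1 hD hd hdθ hdD
    rw [← hA, ← hq] at h1 h2
    rw [← hP] at h2
    have h3 : ∑ l ∈ Finset.range (n + 1), |q l - expCoeff d l / P| ≤ 2 * (1 + D) * A := by
      have h4 : ∀ l, |P * q l - expCoeff d l| = P * |q l - expCoeff d l / P| := by
        intro l
        rw [← abs_of_pos hP0, ← abs_mul, abs_of_pos hP0, mul_sub, mul_div_cancel₀ _ hP0.ne']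
      simp only [h4, ← Finset.mul_sum] at h2
      refine le_of_mul_le_mul_left (h2.trans (le_of_eq ?_)) hP0
      ring
    have h5 : ∑ l ∈ Finset.range (n + 1), |delay (m + 1) q l - expCoeff d l / P| ≤
        2 * A * (2 + D + (1 - x) * (m + 1)) := by
      have h6 : ∑ l ∈ Finset.range (n + 1), |delay (m + 1) q l - expCoeff d l / P| ≤
          ∑ l ∈ Finset.range (n + 1), (|q l - delay (m + 1) q l| + |q l - expCoeff d l / P|) := by
        refine Finset.sum_le_sum fun l _ => ?_
        rw [abs_sub_comm (q l) (delay (m + 1) q l)]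
        exact abs_sub_le _ _ _
      rw [Finset.sum_add_distrib] at h6
      push_cast at h1
      linarith
    have h7 : ‖logDerivCoeff b d m * (x : ℂ) ^ m‖ ≤ D * σ m * x ^ m := by
      rw [norm_mul, norm_pow, Complex.norm_real, Real.norm_of_nonneg hx0.le]
      exact mul_le_mul_of_nonneg_right (hS m) (by positivity)
    simp only [norm_mul (_ * _), ← Finset.mul_sum, Complex.norm_real, Real.norm_eq_abs]
    refine (mul_le_mul h7 h5 (Finset.sum_nonneg fun _ _ => abs_nonneg _)
      ((norm_nonneg _).trans h7)).trans (le_of_eq ?_)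
    simp only [hσ]
    ring
  · set E0 := ∑ k ∈ Finset.Icc 1 n, ε k * x ^ (k - 1) with hE0
    have hE00 : 0 ≤ E0 := Finset.sum_nonneg fun k _ => mul_nonneg (hε0 k) (by positivity)
    have h8 := one_sub_mul_sum_mul_pow_le hD hdD hx0.le hx1.le
    have h9 : ∑ k ∈ Finset.Icc 1 n, ε k * (x ^ (k - 1) * (2 + 2 * D + k * (1 - x))) =
        (2 + 2 * D) * E0 + (1 - x) * ∑ k ∈ Finset.Icc 1 n, k * (ε k * x ^ (k - 1)) := by
      rw [hE0, Finset.mul_sum, Finset.mul_sum, ← Finset.sum_add_distrib]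
      exact Finset.sum_congr rfl fun k _ => by ring
    rw [h9]
    have h10 := mul_le_mul_of_nonneg_left h8 (by positivity : 0 ≤ 2 * A * D * P * E0)
    linarith

theorem one_sub_pow_le {x : ℝ} (hx0 : 0 ≤ x) (k : ℕ) : 1 - x ^ k ≤ k * (1 - x) := by
  have := one_add_mul_le_pow (a := x - 1) (by linarith) k
  rw [add_sub_cancel] at this
  linarith

/-- The crude bound near `x = 1`: there `1 - x^k ≤ k / n`, so the coefficients of `q` up to `n` sum
to at most `exp D`, and no cancellation is needed. -/
theorem sum_norm_interpDeriv_le {b : ℕ → ℂ} {d ε : ℕ → ℝ} {n : ℕ} {D x : ℝ} (hn : 1 ≤ n)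
    (hx0 : 0 ≤ x) (hx1 : x ≤ 1) (hxn : 1 - x ≤ 1 / n) (hD : 0 ≤ D)
    (hd0 : ∀ k, 1 ≤ k → 0 ≤ d k) (hdD : ∀ k, 1 ≤ k → k ≤ n → d k ≤ D) (hε0 : ∀ k, 0 ≤ ε k)
    (hb : ∀ k, 1 ≤ k → ‖b k‖ ≤ D * ε k) (hbd : ∀ k, 1 ≤ k → ‖b k + (d k : ℂ)‖ ≤ d k) :
    ∑ l ∈ Finset.range (n + 1), ‖interpDeriv b d l x‖ ≤
      D * Real.exp D * (∑ k ∈ Finset.Icc 1 n, ε k) *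
        ∑ j ∈ Finset.range (n + 1), expCoeff d j := by
  set q := expCoeff (fun k => d k * (1 - x ^ k)) with hq
  have hn0 : (0 : ℝ) < n := by exact_mod_cast hn
  have hw : ∀ k, 0 ≤ 1 - x ^ k := fun k => sub_nonneg.2 (pow_le_one₀ hx0 hx1)
  have hq0 : ∀ j, 0 ≤ q j := fun j =>
    expCoeff_nonneg fun k hk _ => mul_nonneg (hd0 k hk) (hw k)
  have hp0 : ∀ j, 0 ≤ expCoeff d j := fun j => expCoeff_nonneg fun k hk _ => hd0 k hk
  have hS : ∀ m, ‖logDerivCoeff b d m‖ ≤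
      D * ∑ i ∈ Finset.range (m + 1), ε (i + 1) * expCoeff d (m - i) :=
    norm_logDerivCoeff_le hb hbd
  have h1 : ∑ l ∈ Finset.range (n + 1), ‖interpDeriv b d l x‖ ≤
      ∑ l ∈ Finset.range n, ∑ m ∈ Finset.range (l + 1), ‖logDerivCoeff b d m‖ * q (l - m) := by
    rw [Finset.sum_range_succ']
    have : interpDeriv b d 0 x = 0 := by simp [interpDeriv]
    rw [this, norm_zero, add_zero]
    refine Finset.sum_le_sum fun l _ => ?_
    rw [interpDeriv]
    refine (norm_sum_le _ _).trans (Finset.sum_le_sum fun m _ => ?_)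
    rw [norm_mul, norm_mul, norm_pow, Complex.norm_real, Complex.norm_real,
      Real.norm_of_nonneg hx0, Nat.add_sub_cancel, ← hq, Real.norm_of_nonneg (hq0 _)]
    exact mul_le_mul_of_nonneg_right
      (mul_le_of_le_one_right (norm_nonneg _) (pow_le_one₀ hx0 hx1)) (hq0 _)
  have h2 : ∑ m ∈ Finset.range n, q m ≤ Real.exp D := by
    calc ∑ m ∈ Finset.range n, q m ≤ ∑ m ∈ Finset.range (n + 1), q m :=
          Finset.sum_le_sum_of_subset_of_nonneg (Finset.range_subset_range.2 (by omega))
            fun j _ _ => hq0 j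
      _ ≤ Real.exp (∑ k ∈ Finset.Icc 1 n, d k * (1 - x ^ k) / k) :=
          sum_expCoeff_le fun k hk _ => mul_nonneg (hd0 k hk) (hw k)
      _ ≤ Real.exp D := by
          rw [Real.exp_le_exp]
          have h3 : ∀ k ∈ Finset.Icc 1 n, d k * (1 - x ^ k) / k ≤ D / n := by
            intro k hk
            have hk := Finset.mem_Icc.1 hk
            have hk0 : (0 : ℝ) < k := by exact_mod_cast hk.1
            rw [mul_div_assoc, div_eq_mul_one_div D]
            refine mul_le_mul (hdD k hk.1 hk.2) ?_ (div_nonneg (hw k) hk0.le) hD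
            refine le_trans ?_ hxn
            rw [div_le_iff₀ hk0, mul_comm]
            exact one_sub_pow_le hx0 k
          have h4 := Finset.sum_le_card_nsmul _ _ _ h3
          simp only [Nat.card_Icc, Nat.add_sub_cancel, nsmul_eq_mul] at h4
          rwa [mul_div_cancel₀ _ hn0.ne'] at h4
  have hsub : ∑ j ∈ Finset.range n, expCoeff d j ≤ ∑ j ∈ Finset.range (n + 1), expCoeff d j :=
    Finset.sum_le_sum_of_subset_of_nonneg (Finset.range_subset_range.2 (by omega))
      fun j _ _ => hp0 j
  have hεsum : ∑ i ∈ Finset.range n, ε (i + 1) = ∑ k ∈ Finset.Icc 1 n, ε k := by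
    rw [Finset.range_eq_Ico, Finset.sum_Ico_add' ε 0 n 1]
    rfl
  have h5 : ∑ m ∈ Finset.range n, ‖logDerivCoeff b d m‖ ≤
      D * ((∑ k ∈ Finset.Icc 1 n, ε k) * ∑ j ∈ Finset.range (n + 1), expCoeff d j) := by
    calc _ ≤ ∑ m ∈ Finset.range n,
          D * ∑ i ∈ Finset.range (m + 1), ε (i + 1) * expCoeff d (m - i) :=
          Finset.sum_le_sum fun m _ => hS m
      _ = D * ∑ m ∈ Finset.range n,
          ∑ i ∈ Finset.range (m + 1), ε (i + 1) * expCoeff d (m - i) := by rw [Finset.mul_sum]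
      _ ≤ D * ((∑ i ∈ Finset.range n, ε (i + 1)) * ∑ j ∈ Finset.range n, expCoeff d j) :=
          mul_le_mul_of_nonneg_left
            (sum_conv_le (e := fun i => ε (i + 1)) (fun i _ => hε0 _) fun i _ => hp0 i) hD
      _ ≤ _ := by
          rw [hεsum]
          exact mul_le_mul_of_nonneg_left (mul_le_mul_of_nonneg_left hsub
            (Finset.sum_nonneg fun k _ => hε0 k)) hD
  have h6 := sum_conv_le (e := fun m => ‖logDerivCoeff b d m‖) (f := q) (n := n)
    (fun i _ => norm_nonneg _) fun i _ => hq0 i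
  refine (h1.trans h6).trans ((mul_le_mul h5 h2 (Finset.sum_nonneg fun j _ => hq0 j)
    ((Finset.sum_nonneg fun j _ => norm_nonneg _).trans h5)).trans (le_of_eq ?_))
  ring

end DerivativeBounds

/-! ### Integrating the derivative bounds over `x`. -/

section KernelIntegral

open MeasureTheory intervalIntegral in
theorem sum_norm_sub_le_integral {ι : Type*} {s : Finset ι} {φ φ' : ι → ℝ → ℂ} {B : ℝ → ℝ}
    {u v : ℝ} (huv : u ≤ v) (hφ : ∀ i ∈ s, ∀ x, HasDerivAt (φ i) (φ' i x) x)
    (hφ' : ∀ i ∈ s, Continuous (φ' i)) (hB : IntervalIntegrable B volume u v)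
    (h : ∀ x ∈ Set.Ioo u v, ∑ i ∈ s, ‖φ' i x‖ ≤ B x) :
    ∑ i ∈ s, ‖φ i v - φ i u‖ ≤ ∫ x in u..v, B x := by
  calc ∑ i ∈ s, ‖φ i v - φ i u‖ ≤ ∑ i ∈ s, ∫ x in u..v, ‖φ' i x‖ := by
        refine Finset.sum_le_sum fun i hi => ?_
        rw [← integral_eq_sub_of_hasDerivAt (fun x _ => hφ i hi x)
          ((hφ' i hi).intervalIntegrable u v)]
        exact norm_integral_le_integral_norm huv
    _ = ∫ x in u..v, ∑ i ∈ s, ‖φ' i x‖ :=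
        (integral_finsetSum fun i hi => (hφ' i hi).norm.intervalIntegrable u v).symm
    _ ≤ ∫ x in u..v, B x :=
        integral_mono_on_of_le_Ioo huv
          ((continuous_finsetSum _ fun i hi => (hφ' i hi).norm).intervalIntegrable u v) hB h

theorem continuousOn_one_sub_rpow {ρ : ℝ} (hρ : ρ < 1) (r : ℝ) :
    ContinuousOn (fun x : ℝ => (1 - x) ^ r) (Set.Iic ρ) :=
  ContinuousOn.rpow_const (by fun_prop) fun x hx => Or.inl (by
    have := Set.mem_Iic.1 hx
    linarith)

theorem uIcc_subset_Iic {u v ρ : ℝ} (hu : u ≤ ρ) (hv : v ≤ ρ) : Set.uIcc u v ⊆ Set.Iic ρ :=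
  fun _ hx => (Set.mem_uIcc.1 hx).elim (fun h => h.2.trans hv) fun h => h.2.trans hu

open MeasureTheory in
theorem intervalIntegrable_one_sub_rpow_mul {ρ u v : ℝ} (hρ : ρ < 1) (hu : u ≤ ρ) (hv : v ≤ ρ)
    (r : ℝ) {f : ℝ → ℝ} (hf : Continuous f) :
    IntervalIntegrable (fun x => (1 - x) ^ r * f x) volume u v :=
  (((continuousOn_one_sub_rpow hρ r).mono (uIcc_subset_Iic hu hv)).mul
    hf.continuousOn).intervalIntegrable

-- The range is split at `1 - 1/k`. To the left `(1 - x)^(-θ) ≤ k^θ` and `x^(k-1)` integrates to at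
-- most `1/k`; to the right the power of `x` is dropped.
open intervalIntegral in
theorem integral_one_sub_rpow_mul_pow_le {n k : ℕ} (hk : 1 ≤ k) (hkn : k ≤ n) {θ : ℝ}
    (hθ : 0 < θ) :
    ∫ x in (0 : ℝ)..(1 - 1 / n), (1 - x) ^ (-θ) * x ^ (k - 1) ≤
      (k : ℝ) ^ (θ - 1) + ∫ x in (1 / n : ℝ)..(1 / k), x ^ (-θ) := by
  have hk0 : (0 : ℝ) < k := by exact_mod_cast hk
  have hkn' : (k : ℝ) ≤ n := by exact_mod_cast hkn
  have hn0 : (0 : ℝ) < n := hk0.trans_le hkn'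
  have hρ : 1 - 1 / (n : ℝ) < 1 := by
    have : 0 < 1 / (n : ℝ) := by positivity
    linarith
  have haρ : 1 - 1 / (k : ℝ) ≤ 1 - 1 / n := by
    have := one_div_le_one_div_of_le hk0 hkn'
    linarith
  have ha0 : 0 ≤ 1 - 1 / (k : ℝ) := by
    have : 1 / (k : ℝ) ≤ 1 := by
      rw [div_le_one hk0]
      exact_mod_cast hk
    linarith
  have hpos : 0 < 1 / (k : ℝ) := by positivity
  rw [← integral_add_adjacent_intervals
    (intervalIntegrable_one_sub_rpow_mul hρ (ha0.trans haρ) haρ (-θ) (continuous_pow (k - 1)))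
    (intervalIntegrable_one_sub_rpow_mul hρ haρ le_rfl (-θ) (continuous_pow (k - 1)))]
  refine add_le_add ?_ ?_
  · calc ∫ x in (0 : ℝ)..(1 - 1 / k), (1 - x) ^ (-θ) * x ^ (k - 1)
        ≤ ∫ x in (0 : ℝ)..(1 - 1 / k), (k : ℝ) ^ θ * x ^ (k - 1) := by
          refine integral_mono_on ha0
            (intervalIntegrable_one_sub_rpow_mul hρ (ha0.trans haρ) haρ (-θ)
              (continuous_pow (k - 1)))
            (Continuous.intervalIntegrable (by fun_prop) _ _) fun x hx => ?_
          refine mul_le_mul_of_nonneg_right ?_ (pow_nonneg hx.1 _)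
          have h1 : 1 / (k : ℝ) ≤ 1 - x := by linarith [hx.2]
          calc (1 - x) ^ (-θ) ≤ (1 / (k : ℝ)) ^ (-θ) :=
                Real.rpow_le_rpow_of_nonpos hpos h1 (by linarith)
            _ = (k : ℝ) ^ θ := by
                rw [one_div, Real.inv_rpow hk0.le, Real.rpow_neg hk0.le, inv_inv]
      _ = (k : ℝ) ^ θ * ((1 - 1 / (k : ℝ)) ^ k / k) := by
          rw [integral_const_mul, integral_pow, Nat.sub_add_cancel hk]
          have : ((k - 1 : ℕ) : ℝ) + 1 = k := by
            rw [Nat.cast_sub hk]; simp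
          rw [this, zero_pow (by omega), sub_zero]
      _ ≤ (k : ℝ) ^ θ * (1 / k) := by
          have h2 : (1 - 1 / (k : ℝ)) ^ k ≤ 1 := pow_le_one₀ ha0 (by linarith)
          gcongr
      _ = (k : ℝ) ^ (θ - 1) := by
          rw [Real.rpow_sub_one hk0.ne']
          ring
  · calc ∫ x in (1 - 1 / k : ℝ)..(1 - 1 / n), (1 - x) ^ (-θ) * x ^ (k - 1)
        ≤ ∫ x in (1 - 1 / k : ℝ)..(1 - 1 / n), (1 - x) ^ (-θ) := by
          refine integral_mono_on haρ
            (intervalIntegrable_one_sub_rpow_mul hρ haρ le_rfl (-θ) (continuous_pow (k - 1)))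
            ((continuousOn_one_sub_rpow hρ (-θ)).mono
              (uIcc_subset_Iic haρ le_rfl)).intervalIntegrable fun x hx => ?_
          exact mul_le_of_le_one_right (Real.rpow_nonneg (by linarith [hx.2]) _)
            (pow_le_one₀ (ha0.trans hx.1) (by linarith [hx.2]))
      _ = ∫ x in (1 / n : ℝ)..(1 / k), x ^ (-θ) := by
          rw [integral_comp_sub_left (fun x : ℝ => x ^ (-θ)) 1, sub_sub_cancel, sub_sub_cancel]

open intervalIntegral in
theorem integral_kernel_le {n k : ℕ} (hk : 1 ≤ k) (hkn : k ≤ n) {θ c : ℝ} (hθ : 0 < θ)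
    (hθ1 : θ ≤ 1) :
    ∫ x in (0 : ℝ)..(1 - 1 / n), (1 - x) ^ (-θ) * (x ^ (k - 1) * (c + k * (1 - x))) ≤
      (k : ℝ) ^ (θ - 1) +
        (c + 1) * ∫ x in (0 : ℝ)..(1 - 1 / n), (1 - x) ^ (-θ) * x ^ (k - 1) := by
  have hk0 : (0 : ℝ) < k := by exact_mod_cast hk
  have hkn' : (k : ℝ) ≤ n := by exact_mod_cast hkn
  have hn0 : (0 : ℝ) < n := hk0.trans_le hkn'
  have hn1 : (1 : ℝ) ≤ n := by exact_mod_cast hk.trans hkn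
  set ρ : ℝ := 1 - 1 / n with hρdef
  have hρ : ρ < 1 := by
    have : 0 < 1 / (n : ℝ) := by positivity
    linarith
  have hρ0 : 0 ≤ ρ := by
    have : 1 / (n : ℝ) ≤ 1 := by rwa [div_le_one hn0]
    linarith
  -- The derivative of `x^k (1 - x)^(1 - θ)`; it absorbs the term `k (1 - x) x^(k-1)` of the kernel
  -- up to `(1 - θ) x^k ≤ x^(k-1)`, which explains the `c + 1`.
  set φ' : ℝ → ℝ := fun x => (1 - x) ^ (-θ) *
    (k * x ^ (k - 1) * (1 - x) - (1 - θ) * x ^ k) with hφ'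
  have hφ'int := intervalIntegrable_one_sub_rpow_mul hρ hρ0 le_rfl (-θ)
    (f := fun x => k * x ^ (k - 1) * (1 - x) - (1 - θ) * x ^ k) (by fun_prop)
  have hφ : ∀ x ∈ Set.uIcc 0 ρ,
      HasDerivAt (fun x : ℝ => x ^ k * (1 - x) ^ (1 - θ)) (φ' x) x := by
    intro x hx
    have hx1 : x < 1 := lt_of_le_of_lt (uIcc_subset_Iic hρ0 le_rfl hx) hρ
    have h0 : 0 < 1 - x := by linarith
    have h1 : HasDerivAt (fun x : ℝ => 1 - x) (-1) x := by
      simpa using (hasDerivAt_id x).const_sub 1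
    have h2 := (hasDerivAt_pow k x).mul (h1.rpow_const (p := 1 - θ) (Or.inl h0.ne'))
    refine h2.congr_deriv ?_
    have e1 : (1 - θ - 1 : ℝ) = -θ := by ring
    have e2 : (1 - x) ^ (1 - θ) = (1 - x) ^ (-θ) * (1 - x) := by
      rw [← Real.rpow_add_one h0.ne']
      congr 1
      ring
    rw [e1, e2, hφ']
    ring
  have hFTC := integral_eq_sub_of_hasDerivAt hφ hφ'int
  have hJ := intervalIntegrable_one_sub_rpow_mul hρ hρ0 le_rfl (-θ) (continuous_pow (k - 1))
  calc ∫ x in (0 : ℝ)..ρ, (1 - x) ^ (-θ) * (x ^ (k - 1) * (c + k * (1 - x)))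
      ≤ ∫ x in (0 : ℝ)..ρ, (φ' x + (c + 1) * ((1 - x) ^ (-θ) * x ^ (k - 1))) := by
        refine integral_mono_on hρ0
          (intervalIntegrable_one_sub_rpow_mul hρ hρ0 le_rfl (-θ)
            (f := fun x => x ^ (k - 1) * (c + k * (1 - x))) (by fun_prop))
          (hφ'int.add (hJ.const_mul _)) fun x hx => ?_
        have hx0 := hx.1
        have h1 : 0 ≤ (1 - x) ^ (-θ) := Real.rpow_nonneg (by linarith [hx.2]) _
        have h2 : x ^ k ≤ x ^ (k - 1) :=
          pow_le_pow_of_le_one hx0 (by linarith [hx.2]) (Nat.sub_le k 1)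
        have h3 : 0 ≤ x ^ k := pow_nonneg hx0 k
        have h4 : (1 - θ) * x ^ k ≤ x ^ (k - 1) := by nlinarith
        have h5 := mul_le_mul_of_nonneg_left h4 h1
        simp only [hφ']
        linarith
    _ = (ρ ^ k * (1 - ρ) ^ (1 - θ) - 0 ^ k * (1 - 0) ^ (1 - θ)) +
          (c + 1) * ∫ x in (0 : ℝ)..ρ, (1 - x) ^ (-θ) * x ^ (k - 1) := by
        rw [integral_add hφ'int (hJ.const_mul _), hFTC, integral_const_mul]
    _ ≤ _ := by
        refine add_le_add ?_ le_rfl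
        rw [zero_pow (by omega), zero_mul, sub_zero, hρdef, sub_sub_cancel, ← hρdef]
        have h6 : (1 / (n : ℝ)) ^ (1 - θ) ≤ (1 / (k : ℝ)) ^ (1 - θ) :=
          Real.rpow_le_rpow (by positivity) (one_div_le_one_div_of_le hk0 hkn') (by linarith)
        have h7 : (1 / (k : ℝ)) ^ (1 - θ) = (k : ℝ) ^ (θ - 1) := by
          rw [one_div, Real.inv_rpow hk0.le, ← Real.rpow_neg hk0.le]
          congr 1
          ring
        rw [← h7]
        exact (mul_le_of_le_one_left (Real.rpow_nonneg (by positivity) _)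
          (pow_le_one₀ hρ0 hρ.le)).trans h6

open intervalIntegral in
theorem integral_kernel_le_of_lt_one {n k : ℕ} (hk : 1 ≤ k) (hkn : k ≤ n) {θ c : ℝ} (hθ : 0 < θ)
    (hθ1 : θ < 1) (hc : 0 ≤ c) :
    ∫ x in (0 : ℝ)..(1 - 1 / n), (1 - x) ^ (-θ) * (x ^ (k - 1) * (c + k * (1 - x))) ≤
      (1 + (c + 1) * (1 + 1 / (1 - θ))) * (k : ℝ) ^ (θ - 1) := by
  have hk0 : (0 : ℝ) < k := by exact_mod_cast hk
  have h1 := integral_kernel_le hk hkn (c := c) hθ hθ1.le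
  have h2 := integral_one_sub_rpow_mul_pow_le hk hkn hθ
  have h3 : ∫ x in (1 / n : ℝ)..(1 / k), x ^ (-θ) ≤ 1 / (1 - θ) * (k : ℝ) ^ (θ - 1) := by
    rw [integral_rpow (Or.inl (by linarith)), show -θ + 1 = 1 - θ by ring, div_eq_mul_one_div,
      mul_comm]
    refine mul_le_mul_of_nonneg_left ?_ (by
      have : 0 < 1 - θ := by linarith
      positivity)
    have h7 : (1 / (k : ℝ)) ^ (1 - θ) = (k : ℝ) ^ (θ - 1) := by
      rw [one_div, Real.inv_rpow hk0.le, ← Real.rpow_neg hk0.le]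
      congr 1
      ring
    rw [h7]
    have : 0 ≤ (1 / (n : ℝ)) ^ (1 - θ) := Real.rpow_nonneg (by positivity) _
    linarith
  have h4 := mul_le_mul_of_nonneg_left (h2.trans (add_le_add le_rfl h3)) (by linarith : 0 ≤ c + 1)
  linarith

open intervalIntegral in
theorem integral_kernel_le_of_eq_one {n k : ℕ} (hk : 1 ≤ k) (hkn : k ≤ n) {c : ℝ} (hc : 0 ≤ c) :
    ∫ x in (0 : ℝ)..(1 - 1 / n), (1 - x) ^ (-1 : ℝ) * (x ^ (k - 1) * (c + k * (1 - x))) ≤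
      (c + 2) * (1 + Real.log ((n : ℝ) / k)) := by
  have hk0 : (0 : ℝ) < k := by exact_mod_cast hk
  have hkn' : (k : ℝ) ≤ n := by exact_mod_cast hkn
  have hn0 : (0 : ℝ) < n := hk0.trans_le hkn'
  have h1 := integral_kernel_le hk hkn (c := c) one_pos le_rfl
  have h2 := integral_one_sub_rpow_mul_pow_le hk hkn one_pos
  have h3 : ∫ x in (1 / n : ℝ)..(1 / k), x ^ (-1 : ℝ) = Real.log ((n : ℝ) / k) := by
    simp only [Real.rpow_neg_one]
    rw [integral_inv_of_pos (by positivity) (by positivity)]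
    congr 1
    field_simp
  rw [h3] at h2
  simp only [sub_self, Real.rpow_zero] at h1 h2
  have h4 : 0 ≤ Real.log ((n : ℝ) / k) := Real.log_nonneg (by rwa [one_le_div hk0])
  have h5 := mul_le_mul_of_nonneg_left h2 (by linarith : 0 ≤ c + 1)
  linarith

end KernelIntegral

/-! ### From the `ℓ¹` estimate to the weighted mean. -/

section MeanValue

theorem norm_expPoly_le_one {b : ℕ → ℂ} {n : ℕ} (hb : ∀ k, 1 ≤ k → (b k).re ≤ 0) {x : ℝ}
    (hx : 0 ≤ x) : ‖expPoly b n x‖ ≤ 1 := by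
  rw [expPoly, Complex.norm_exp, Real.exp_le_one_iff, Complex.re_sum]
  refine Finset.sum_nonpos fun k hk => ?_
  have h : b k * (x : ℂ) ^ k / k = b k * ((x ^ k / k : ℝ) : ℂ) := by
    push_cast
    ring
  rw [h, Complex.re_mul_ofReal]
  exact mul_nonpos_of_nonpos_of_nonneg (hb k (Finset.mem_Icc.1 hk).1) (by positivity)

theorem norm_expPoly_sub_le {b : ℕ → ℂ} {ε : ℕ → ℝ} {n : ℕ} {D u : ℝ} (hu0 : 0 ≤ u) (hu1 : u ≤ 1)
    (hre : ∀ k, 1 ≤ k → (b k).re ≤ 0) (hb : ∀ k, 1 ≤ k → ‖b k‖ ≤ D * ε k) :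
    ‖expPoly b n 1 - expPoly b n u‖ ≤ (1 - u) * (D * ∑ k ∈ Finset.Icc 1 n, ε k) := by
  have h := sum_norm_sub_le_integral (s := {()}) (φ := fun _ => expPoly b n)
    (φ' := fun _ x => (∑ k ∈ Finset.Icc 1 n, b k * (x : ℂ) ^ (k - 1)) * expPoly b n x)
    (B := fun _ => D * ∑ k ∈ Finset.Icc 1 n, ε k) hu1 (fun _ _ x => hasDerivAt_expPoly b n x)
    (fun _ _ => (by fun_prop : Continuous fun x : ℝ => ∑ k ∈ Finset.Icc 1 n,
      b k * (x : ℂ) ^ (k - 1)).mul (continuous_expPoly b n))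
    intervalIntegrable_const fun x hx => by
      have hx0 : 0 ≤ x := hu0.trans hx.1.le
      rw [Finset.sum_singleton, norm_mul, Finset.mul_sum]
      refine (mul_le_of_le_one_right (norm_nonneg _) (norm_expPoly_le_one hre hx0)).trans ?_
      refine (norm_sum_le _ _).trans (Finset.sum_le_sum fun k hk => ?_)
      rw [norm_mul, norm_pow, Complex.norm_real, Real.norm_of_nonneg hx0]
      exact (mul_le_of_le_one_right (norm_nonneg _) (pow_le_one₀ hx0 hx.2.le)).trans
        (hb k (Finset.mem_Icc.1 hk).1)
  rwa [Finset.sum_singleton, intervalIntegral.integral_const, smul_eq_mul] at h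

/-- The `ℓ¹` estimate for the coefficients of `p(z) (g(z) - g(1 - 1 / n))`. -/
theorem sum_norm_expCoeff_sub_le {b : ℕ → ℂ} {d ε : ℕ → ℝ} {n : ℕ} {θ D : ℝ} (hn : 1 ≤ n)
    (hθ0 : 0 < θ) (hθ1 : θ ≤ 1) (hD : 0 ≤ D) (hd : ∀ k, n < k → d k = 0)
    (hdθ : ∀ k, 1 ≤ k → k ≤ n → θ ≤ d k) (hdD : ∀ k, 1 ≤ k → k ≤ n → d k ≤ D)
    (hε : ∀ k, n < k → ε k = 0) (hε0 : ∀ k, 0 ≤ ε k) (hbn : ∀ k, n < k → b k = 0)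
    (hb : ∀ k, 1 ≤ k → ‖b k‖ ≤ D * ε k) (hbd : ∀ k, 1 ≤ k → ‖b k + (d k : ℂ)‖ ≤ d k) :
    ∑ l ∈ Finset.range (n + 1), ‖expCoeff (fun k => b k + (d k : ℂ)) l -
        ((expCoeff d l : ℝ) : ℂ) * expPoly b n (1 - 1 / n)‖ ≤
      (∑ j ∈ Finset.range (n + 1), expCoeff d j) *
        (D * Real.exp D * (1 / n * ∑ k ∈ Finset.Icc 1 n, ε k) +
          4 * D * Real.exp (D * (⌈2 * D⌉₊ + 1)) * ((n : ℝ) ^ (-θ) * ∑ k ∈ Finset.Icc 1 n, ε k *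
            ∫ x in (0 : ℝ)..(1 - 1 / n), (1 - x) ^ (-θ) *
              (x ^ (k - 1) * (2 + 2 * D + k * (1 - x))))) := by
  have hn0 : (0 : ℝ) < n := by exact_mod_cast hn
  have hn1 : (1 : ℝ) ≤ n := by exact_mod_cast hn
  set Q := ∑ j ∈ Finset.range (n + 1), expCoeff d j with hQ
  set K := Real.exp (D * (⌈2 * D⌉₊ + 1)) with hK
  set ρ : ℝ := 1 - 1 / n with hρdef
  have hρ : ρ < 1 := by
    have : 0 < 1 / (n : ℝ) := by positivity
    linarith
  have hρ0 : 0 ≤ ρ := by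
    have : 1 / (n : ℝ) ≤ 1 := by rwa [div_le_one hn0]
    linarith
  have hd0 : ∀ k, 1 ≤ k → 0 ≤ d k := fun k hk => by
    rcases le_or_gt k n with h | h
    · exact hθ0.le.trans (hdθ k hk h)
    · rw [hd k h]
  have h1 := sum_norm_sub_le_integral (s := Finset.range (n + 1)) (φ := interp b d)
    (φ' := interpDeriv b d)
    (B := fun _ => D * Real.exp D * (∑ k ∈ Finset.Icc 1 n, ε k) * Q) hρ.le
    (fun l _ x => hasDerivAt_interp b d l x) (fun l _ => continuous_interpDeriv b d l)
    intervalIntegrable_const fun x hx =>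
      sum_norm_interpDeriv_le hn (hρ0.trans hx.1.le) hx.2.le (by linarith [hx.1]) hD hd0 hdD hε0
        hb hbd
  rw [intervalIntegral.integral_const, smul_eq_mul, hρdef, sub_sub_cancel, ← hρdef] at h1
  have hint : ∀ k ∈ Finset.Icc 1 n, IntervalIntegrable (fun x => ε k * ((1 - x) ^ (-θ) *
      (x ^ (k - 1) * (2 + 2 * D + k * (1 - x))))) MeasureTheory.volume 0 ρ := fun k _ =>
    (intervalIntegrable_one_sub_rpow_mul hρ hρ0 le_rfl (-θ)
      (f := fun x => x ^ (k - 1) * (2 + 2 * D + k * (1 - x))) (by fun_prop)).const_mul _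
  have hint' : IntervalIntegrable (fun x => ∑ k ∈ Finset.Icc 1 n, ε k * ((1 - x) ^ (-θ) *
      (x ^ (k - 1) * (2 + 2 * D + k * (1 - x))))) MeasureTheory.volume 0 ρ :=
    (IntervalIntegrable.sum _ hint).congr fun x _ => by simp only [Finset.sum_apply]
  have h2 := sum_norm_sub_le_integral (s := Finset.range (n + 1))
    (φ := fun l x => interp b d l x - ((expCoeff d l : ℝ) : ℂ) * expPoly b n x)
    (φ' := fun l x => interpDeriv b d l x - ((expCoeff d l : ℝ) : ℂ) *
        ((∑ k ∈ Finset.Icc 1 n, b k * (x : ℂ) ^ (k - 1)) * expPoly b n x))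
    (B := fun x => 4 * D * K * Q * (n : ℝ) ^ (-θ) * ∑ k ∈ Finset.Icc 1 n, ε k *
      ((1 - x) ^ (-θ) * (x ^ (k - 1) * (2 + 2 * D + k * (1 - x))))) hρ0
    (fun l _ x => (hasDerivAt_interp b d l x).sub ((hasDerivAt_expPoly b n x).const_mul _))
    (fun l _ => (continuous_interpDeriv b d l).sub (continuous_const.mul
      ((by fun_prop : Continuous fun x : ℝ => ∑ k ∈ Finset.Icc 1 n,
        b k * (x : ℂ) ^ (k - 1)).mul (continuous_expPoly b n))))
    (hint'.const_mul _) fun x hx => by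
      have hx1 : x < 1 := hx.2.trans hρ
      refine (sum_norm_interpDeriv_sub_le hθ0 hθ1 hx.1 hx1 hD hd hdθ hdD hε hε0 hbn hb hbd).trans ?_
      have h3 := sum_expCoeff_sub_mul_exp_le hn hθ0 hx.1 hx1 hD hd hdθ hdD
      rw [Real.mul_rpow hn0.le (by linarith), ← hQ, ← hK] at h3
      have h4 : 0 ≤ ∑ k ∈ Finset.Icc 1 n, ε k * (x ^ (k - 1) * (2 + 2 * D + k * (1 - x))) :=
        Finset.sum_nonneg fun k _ => mul_nonneg (hε0 k) (mul_nonneg (pow_nonneg hx.1.le _)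
          (add_nonneg (by positivity) (mul_nonneg (Nat.cast_nonneg k) (by linarith))))
      refine (mul_le_mul_of_nonneg_right
        (mul_le_mul_of_nonneg_left h3 (by positivity)) h4).trans (le_of_eq ?_)
      have h5 : ∑ k ∈ Finset.Icc 1 n,
          ε k * ((1 - x) ^ (-θ) * (x ^ (k - 1) * (2 + 2 * D + k * (1 - x)))) =
          (1 - x) ^ (-θ) *
            ∑ k ∈ Finset.Icc 1 n, ε k * (x ^ (k - 1) * (2 + 2 * D + k * (1 - x))) := by
        rw [Finset.mul_sum]
        exact Finset.sum_congr rfl fun k _ => by ring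
      rw [h5]
      ring
  rw [intervalIntegral.integral_const_mul, intervalIntegral.integral_finsetSum hint] at h2
  simp only [intervalIntegral.integral_const_mul] at h2
  -- The path is cut at `ρ = 1 - 1/n`: on `[ρ, 1]` it is bounded alone, on `[0, ρ]` after
  -- subtracting `p_l g(x)`, a difference that vanishes at `x = 0`.
  have h5 : ∀ l, expCoeff (fun k => b k + (d k : ℂ)) l -
      ((expCoeff d l : ℝ) : ℂ) * expPoly b n ρ =
      (interp b d l 1 - interp b d l ρ) +
        ((interp b d l ρ - ((expCoeff d l : ℝ) : ℂ) * expPoly b n ρ) -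
          (interp b d l 0 - ((expCoeff d l : ℝ) : ℂ) * expPoly b n 0)) := by
    intro l
    have h6 : expPoly b n 0 = 1 := by
      rw [expPoly, Finset.sum_eq_zero, Complex.exp_zero]
      intro k hk
      rw [Complex.ofReal_zero, zero_pow (by have := Finset.mem_Icc.1 hk; omega), mul_zero,
        zero_div]
    rw [interp_one, interp_zero, h6]
    ring
  calc _ ≤ ∑ l ∈ Finset.range (n + 1), (‖interp b d l 1 - interp b d l ρ‖ +
        ‖(interp b d l ρ - ((expCoeff d l : ℝ) : ℂ) * expPoly b n ρ) -
          (interp b d l 0 - ((expCoeff d l : ℝ) : ℂ) * expPoly b n 0)‖) :=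
        Finset.sum_le_sum fun l _ => by
          rw [h5]
          exact norm_add_le _ _
    _ ≤ _ := by
        rw [Finset.sum_add_distrib]
        refine (add_le_add h1 h2).trans (le_of_eq ?_)
        ring

/-- Passing from the `ℓ¹` estimate to a pointwise one by means of the recurrence. -/
theorem mul_norm_expCoeff_sub_le {b : ℕ → ℂ} {d ε : ℕ → ℝ} {D : ℝ} (n : ℕ)
    (hd0 : ∀ k, 1 ≤ k → 0 ≤ d k) (hdD : ∀ k, 1 ≤ k → d k ≤ D)
    (hb : ∀ k, 1 ≤ k → ‖b k‖ ≤ D * ε k) (hbd : ∀ k, 1 ≤ k → ‖b k + (d k : ℂ)‖ ≤ d k) (z : ℂ) :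
    ((n : ℝ) + 1) * ‖expCoeff (fun k => b k + (d k : ℂ)) (n + 1) -
        ((expCoeff d (n + 1) : ℝ) : ℂ) * z‖ ≤
      D * (∑ i ∈ Finset.range (n + 1), ε (i + 1) * expCoeff d (n - i) +
        ∑ l ∈ Finset.range (n + 1), ‖expCoeff (fun k => b k + (d k : ℂ)) l -
          ((expCoeff d l : ℝ) : ℂ) * z‖) := by
  set F := expCoeff (fun k => b k + (d k : ℂ)) with hF
  -- The recurrence for `g p`, with weights `b + d`, minus `z` times the recurrence for `p`; the
  -- `b`-part is exactly a coefficient of `g' p`.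
  have h1 : ((n : ℂ) + 1) * (F (n + 1) - ((expCoeff d (n + 1) : ℝ) : ℂ) * z) =
      logDerivCoeff b d n + ∑ i ∈ Finset.range (n + 1), (d (i + 1) : ℂ) *
        (F (n - i) - ((expCoeff d (n - i) : ℝ) : ℂ) * z) := by
    have h2 := succ_mul_expCoeff (fun k => b k + (d k : ℂ)) n
    have h3 := succ_mul_expCoeff (fun k => (d k : ℂ)) n
    simp only [expCoeff_ofReal] at h3
    rw [← hF] at h2
    rw [mul_sub, ← mul_assoc, h2, h3, logDerivCoeff, ← hF, Finset.sum_mul,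
      ← Finset.sum_sub_distrib, ← Finset.sum_add_distrib]
    exact Finset.sum_congr rfl fun i _ => by ring
  have h4 : ((n : ℝ) + 1) * ‖F (n + 1) - ((expCoeff d (n + 1) : ℝ) : ℂ) * z‖ =
      ‖((n : ℂ) + 1) * (F (n + 1) - ((expCoeff d (n + 1) : ℝ) : ℂ) * z)‖ := by
    rw [norm_mul, ← Nat.cast_add_one, ← Nat.cast_add_one, Complex.norm_natCast]
  rw [h4, h1, mul_add]
  refine (norm_add_le _ _).trans (add_le_add (norm_logDerivCoeff_le hb hbd n) ?_)
  rw [← Finset.sum_range_reflect (fun l => ‖F l - ((expCoeff d l : ℝ) : ℂ) * z‖), Finset.mul_sum]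
  refine (norm_sum_le _ _).trans (Finset.sum_le_sum fun i _ => ?_)
  rw [norm_mul, Complex.norm_real, Real.norm_of_nonneg (hd0 _ (by omega)), Nat.add_sub_cancel]
  exact mul_le_mul_of_nonneg_right (hdD _ (by omega)) (norm_nonneg _)

/-- Dividing by `p_n` is affordable because `n p_n` is at least a constant times the partial sum of
the `p_j`. Replacing `g(1 - 1/n)` by `g(1)` costs only a term of order `1/n`. -/
theorem norm_expCoeff_div_sub_le {θ D : ℝ} (hθ0 : 0 < θ) (hθ1 : θ ≤ 1) (hD : 0 < D) :
    ∃ C : ℝ, 0 < C ∧ ∀ (b : ℕ → ℂ) (d ε : ℕ → ℝ) (n : ℕ), 1 ≤ n → (∀ k, n < k → d k = 0) →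
    (∀ k, 1 ≤ k → k ≤ n → θ ≤ d k) → (∀ k, 1 ≤ k → k ≤ n → d k ≤ D) →
    (∀ k, n < k → ε k = 0) → (∀ k, 0 ≤ ε k) → (∀ k, n < k → b k = 0) →
    (∀ k, 1 ≤ k → ‖b k‖ ≤ D * ε k) → (∀ k, 1 ≤ k → ‖b k + (d k : ℂ)‖ ≤ d k) →
    ‖expCoeff (fun k => b k + (d k : ℂ)) n / ((expCoeff d n : ℝ) : ℂ) - expPoly b n 1‖ ≤
      C * ((∑ j ∈ Finset.range (n + 1), expCoeff d j)⁻¹ *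
          ∑ k ∈ Finset.Icc 1 n, ε k * expCoeff d (n - k) +
        (n : ℝ) ^ (-θ) * ∑ k ∈ Finset.Icc 1 n, ε k *
            (∫ x in (0 : ℝ)..(1 - 1 / n), (1 - x) ^ (-θ) *
              (x ^ (k - 1) * (2 + 2 * D + k * (1 - x)))) +
        1 / n * ∑ k ∈ Finset.Icc 1 n, ε k) := by
  set K := Real.exp (D * (⌈2 * D⌉₊ + 1)) with hK
  have hK0 : 0 < K := Real.exp_pos _
  have hE0 : 0 < Real.exp D := Real.exp_pos _
  refine ⟨(1 + D) / θ * D * (1 + D * Real.exp D + 4 * D * K) + D, by positivity, ?_⟩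
  intro b d ε n hn hd hdθ hdD hε hε0 hbn hb hbd
  have hn0 : (0 : ℝ) < n := by exact_mod_cast hn
  have hd0 : ∀ k, 1 ≤ k → 0 ≤ d k := fun k hk => by
    rcases le_or_gt k n with h | h
    · exact hθ0.le.trans (hdθ k hk h)
    · rw [hd k h]
  have hdD' : ∀ k, 1 ≤ k → d k ≤ D := fun k hk => by
    rcases le_or_gt k n with h | h
    · exact hdD k hk h
    · rw [hd k h]
      exact hD.le
  have hp : ∀ j, 0 ≤ expCoeff d j := fun j => expCoeff_nonneg fun k hk _ => hd0 k hk
  set Q := ∑ j ∈ Finset.range (n + 1), expCoeff d j with hQ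
  have hQ0 : 0 < Q := by
    rw [hQ, Finset.sum_range_succ', expCoeff_zero]
    have := Finset.sum_nonneg (s := Finset.range n) fun j _ => hp (j + 1)
    linarith
  set V := ∑ k ∈ Finset.Icc 1 n, ε k * expCoeff d (n - k) with hV
  set E := ∑ k ∈ Finset.Icc 1 n, ε k with hE
  set J := (n : ℝ) ^ (-θ) * ∑ k ∈ Finset.Icc 1 n, ε k *
    (∫ x in (0 : ℝ)..(1 - 1 / n), (1 - x) ^ (-θ) *
      (x ^ (k - 1) * (2 + 2 * D + k * (1 - x)))) with hJ
  set ρ : ℝ := 1 - 1 / n with hρdef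
  set z := expPoly b n ρ with hz
  set F := expCoeff (fun k => b k + (d k : ℂ)) with hF
  have hρ1 : ρ ≤ 1 := by
    have : 0 < 1 / (n : ℝ) := by positivity
    linarith
  have hρ0 : 0 ≤ ρ := by
    have : 1 / (n : ℝ) ≤ 1 := by
      rw [div_le_one hn0]
      exact_mod_cast hn
    linarith
  have hE00 : 0 ≤ E := Finset.sum_nonneg fun k _ => hε0 k
  have hV0 : 0 ≤ V := Finset.sum_nonneg fun k _ => mul_nonneg (hε0 k) (hp _)
  have hJ0 : 0 ≤ J := by
    refine mul_nonneg (Real.rpow_nonneg hn0.le _) (Finset.sum_nonneg fun k _ =>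
      mul_nonneg (hε0 k) (intervalIntegral.integral_nonneg hρ0 fun x hx => ?_))
    have h0 : 0 ≤ 1 - x := by linarith [hx.2]
    have := hx.1
    positivity
  -- The disc condition `‖b k + d k‖ ≤ d k` lies in the half-plane `Re ≤ 0`, which gives `|g| ≤ 1`
  -- on `[0, 1]`.
  have hre : ∀ k, 1 ≤ k → (b k).re ≤ 0 := fun k hk => by
    have := (Complex.re_le_norm (b k + (d k : ℂ))).trans (hbd k hk)
    rw [Complex.add_re, Complex.ofReal_re] at this
    linarith
  have h1 := sum_norm_expCoeff_sub_le hn hθ0 hθ1 hD.le hd hdθ hdD hε hε0 hbn hb hbd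
  rw [← hQ, ← hJ, ← hE, ← hK, ← hF, ← hz] at h1
  have h2 : (n : ℝ) * ‖F n - ((expCoeff d n : ℝ) : ℂ) * z‖ ≤
      D * (V + ∑ l ∈ Finset.range n, ‖F l - ((expCoeff d l : ℝ) : ℂ) * z‖) := by
    obtain ⟨m, rfl⟩ : ∃ m, n = m + 1 := ⟨n - 1, by omega⟩
    have h3 := mul_norm_expCoeff_sub_le m hd0 hdD' hb hbd z
    have h4 : V = ∑ i ∈ Finset.range (m + 1), ε (i + 1) * expCoeff d (m - i) := by
      have h5 := Finset.sum_Ico_add' (fun k => ε k * expCoeff d (m + 1 - k)) 0 (m + 1) 1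
      simp only [Nat.add_sub_add_right, ← Finset.range_eq_Ico] at h5
      exact h5.symm
    rw [h4]
    push_cast
    exact h3
  have h3 : ∑ l ∈ Finset.range n, ‖F l - ((expCoeff d l : ℝ) : ℂ) * z‖ ≤
      ∑ l ∈ Finset.range (n + 1), ‖F l - ((expCoeff d l : ℝ) : ℂ) * z‖ :=
    Finset.sum_le_sum_of_subset_of_nonneg (Finset.range_subset_range.2 (by omega))
      fun _ _ _ => norm_nonneg _
  have h4 : (n : ℝ) * ‖F n - ((expCoeff d n : ℝ) : ℂ) * z‖ ≤
      D * (V + Q * (D * Real.exp D * (1 / n * E) + 4 * D * K * J)) :=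
    h2.trans (mul_le_mul_of_nonneg_left (by linarith) hD.le)
  have hlow : θ / (1 + D) * Q ≤ n * expCoeff d n := by
    have h5 : θ * ∑ j ∈ Finset.range n, expCoeff d j ≤ n * expCoeff d n := by
      obtain ⟨m, rfl⟩ : ∃ m, n = m + 1 := ⟨n - 1, by omega⟩
      rw [Nat.cast_add_one, succ_mul_expCoeff, ← Finset.sum_range_reflect (fun i => expCoeff d i),
        Finset.mul_sum]
      refine Finset.sum_le_sum fun i hi => ?_
      rw [Nat.add_sub_cancel]
      exact mul_le_mul_of_nonneg_right
        (hdθ _ (by omega) (by have := Finset.mem_range.1 hi; omega)) (hp _)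
    have h6 : Q ≤ (1 + D) * ∑ j ∈ Finset.range n, expCoeff d j := by
      have h7 := mul_expCoeff_le hd0 hdD' n
      have h8 : expCoeff d n ≤ n * expCoeff d n :=
        le_mul_of_one_le_left (hp n) (by exact_mod_cast hn)
      rw [hQ, Finset.sum_range_succ]
      linarith
    calc θ / (1 + D) * Q ≤ θ / (1 + D) * ((1 + D) * ∑ j ∈ Finset.range n, expCoeff d j) := by
          gcongr
      _ = θ * ∑ j ∈ Finset.range n, expCoeff d j := by
          field_simp
      _ ≤ _ := h5
  have hpn : 0 < expCoeff d n := by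
    have : 0 < (n : ℝ) * expCoeff d n := lt_of_lt_of_le (by positivity) hlow
    exact pos_of_mul_pos_right this hn0.le
  have h5 : ‖F n / ((expCoeff d n : ℝ) : ℂ) - z‖ ≤
      (1 + D) / θ * D * (Q⁻¹ * V + (D * Real.exp D * (1 / n * E) + 4 * D * K * J)) := by
    have h6 : F n / ((expCoeff d n : ℝ) : ℂ) - z =
        (F n - ((expCoeff d n : ℝ) : ℂ) * z) / ((expCoeff d n : ℝ) : ℂ) := by
      have : ((expCoeff d n : ℝ) : ℂ) ≠ 0 := Complex.ofReal_ne_zero.2 hpn.ne'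
      field_simp
    rw [h6, norm_div, Complex.norm_real, Real.norm_of_nonneg hpn.le, div_le_iff₀ hpn]
    refine le_of_mul_le_mul_left (h4.trans ?_) hn0
    set R := D * Real.exp D * (1 / n * E) + 4 * D * K * J with hR
    have hR0 : 0 ≤ R := by positivity
    have h7 : D * (V + Q * R) = (1 + D) / θ * D * (Q⁻¹ * V + R) * (θ / (1 + D) * Q) := by
      field_simp
    rw [h7]
    calc _ ≤ (1 + D) / θ * D * (Q⁻¹ * V + R) * (n * expCoeff d n) :=
          mul_le_mul_of_nonneg_left hlow (by positivity)
      _ = _ := by ring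
  have h6 := norm_expPoly_sub_le (n := n) hρ0 hρ1 hre hb
  rw [← hE, hρdef, sub_sub_cancel, ← hρdef, ← hz] at h6
  have h7 : ‖F n / ((expCoeff d n : ℝ) : ℂ) - expPoly b n 1‖ ≤
      ‖F n / ((expCoeff d n : ℝ) : ℂ) - z‖ + ‖expPoly b n 1 - z‖ := by
    rw [norm_sub_rev (expPoly b n 1) z]
    exact norm_sub_le_norm_sub_add_norm_sub _ _ _
  have hQV : 0 ≤ Q⁻¹ * V := by positivity
  have hEn : 0 ≤ 1 / n * E := by positivity
  set a := D * Real.exp D with ha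
  have ha0 : 0 < a := by positivity
  set k := 4 * D * K with hk
  have hk0 : 0 < k := by positivity
  set M := (1 + D) / θ * D with hM
  have hM0 : 0 < M := by positivity
  set v := Q⁻¹ * V
  set e := 1 / (n : ℝ) * E with he
  have h8 : 1 / (n : ℝ) * (D * E) = D * e := by rw [he]; ring
  rw [h8] at h6
  have h9 : v + (a * e + k * J) ≤ (1 + a + k) * (v + J + e) := by
    have : 0 ≤ a * v + a * J + k * v + k * e + J + e := by positivity
    linarith
  have h10 := mul_le_mul_of_nonneg_left h9 hM0.le
  have h11 : 0 ≤ D * v + D * J := by positivity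
  linarith

theorem weightedMean_eq {n : ℕ} (d : ℕ → ℝ) (f : Equiv.Perm (Fin n) → ℂ) (fhat : ℕ → ℂ)
    (hf : IsMultiplicativeWith f fhat) :
    weightedMean d f =
      expCoeff (fun k => fhat k * (d k : ℂ)) n / ((expCoeff d n : ℝ) : ℂ) := by
  have hprod : ∀ σ : Equiv.Perm (Fin n), f σ * ((cycleProd d σ : ℝ) : ℂ) =
      cycleProd (fun k => fhat k * (d k : ℂ)) σ := by
    intro σ
    rw [hf σ, cycleProd, cycleProd, cycleProd, Multiset.prod_map_mul]
    congr 1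
    have := map_multiset_prod Complex.ofRealHom (σ.partition.parts.map d)
    rw [Multiset.map_map] at this
    exact this
  have hfac : (n.factorial : ℂ) ≠ 0 := Nat.cast_ne_zero.2 (Nat.factorial_ne_zero n)
  unfold weightedMean cycleMeasure
  simp only [Complex.ofReal_div, ← mul_div_assoc, hprod]
  rw [← Finset.sum_div, sum_cycleProd, sum_cycleProd, Complex.ofReal_mul, Complex.ofReal_natCast,
    mul_div_mul_left _ _ hfac]

/-- The kernel integrals are left unevaluated so that both cases of the theorem follow from one
estimate, with `θ = dm` or `θ = 1`. -/
theorem meanError_le {θ D : ℝ} (hθ0 : 0 < θ) (hθ1 : θ ≤ 1) (hD : 0 < D) :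
    ∃ C : ℝ, 0 < C ∧ ∀ n : ℕ, 1 ≤ n → ∀ d : ℕ → ℝ, (∀ j, 1 ≤ j → j ≤ n → θ ≤ d j ∧ d j ≤ D) →
    ∀ (f : Equiv.Perm (Fin n) → ℂ) (fhat : ℕ → ℂ), IsMultiplicativeWith f fhat →
    (∀ j, 1 ≤ j → j ≤ n → ‖fhat j‖ ≤ 1) →
    meanError d f fhat ≤
      C * ((∑ j ∈ Finset.range (n + 1), cyclePartition d j)⁻¹ *
          ∑ k ∈ Finset.Icc 1 n, ‖fhat k - 1‖ * cyclePartition d (n - k) +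
        (n : ℝ) ^ (-θ) * ∑ k ∈ Finset.Icc 1 n, ‖fhat k - 1‖ *
            (∫ x in (0 : ℝ)..(1 - 1 / n), (1 - x) ^ (-θ) *
              (x ^ (k - 1) * (2 + 2 * D + k * (1 - x)))) +
        1 / n * ∑ k ∈ Finset.Icc 1 n, ‖fhat k - 1‖) := by
  obtain ⟨C, hC, h⟩ := norm_expCoeff_div_sub_le hθ0 hθ1 hD
  refine ⟨C, hC, fun n hn d hd f fhat hf hfhat => ?_⟩
  set b : ℕ → ℂ := fun k => if 1 ≤ k ∧ k ≤ n then (d k : ℂ) * (fhat k - 1) else 0 with hb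
  set d' : ℕ → ℝ := fun k => if 1 ≤ k ∧ k ≤ n then d k else 0 with hd'
  set ε : ℕ → ℝ := fun k => if 1 ≤ k ∧ k ≤ n then ‖fhat k - 1‖ else 0 with hε
  have hd0 : ∀ k, 1 ≤ k → k ≤ n → 0 ≤ d k := fun k h1 h2 => hθ0.le.trans (hd k h1 h2).1
  have hbk : ∀ k, 1 ≤ k → k ≤ n → b k = (d k : ℂ) * (fhat k - 1) := fun k h1 h2 => if_pos ⟨h1, h2⟩
  have hdk : ∀ k, 1 ≤ k → k ≤ n → d' k = d k := fun k h1 h2 => if_pos ⟨h1, h2⟩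
  have hεk : ∀ k, 1 ≤ k → k ≤ n → ε k = ‖fhat k - 1‖ := fun k h1 h2 => if_pos ⟨h1, h2⟩
  have hbn : ∀ k, n < k → b k = 0 := fun k hk => if_neg (by omega)
  have hdn : ∀ k, n < k → d' k = 0 := fun k hk => if_neg (by omega)
  have hεn : ∀ k, n < k → ε k = 0 := fun k hk => if_neg (by omega)
  have hmain := h b d' ε n hn hdn (fun k h1 h2 => by rw [hdk k h1 h2]; exact (hd k h1 h2).1)
    (fun k h1 h2 => by rw [hdk k h1 h2]; exact (hd k h1 h2).2) hεn
    (fun k => by simp only [hε]; split_ifs; exacts [norm_nonneg _, le_rfl]) hbn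
    (fun k hk => by
      rcases le_or_gt k n with h2 | h2
      · rw [hbk k hk h2, hεk k hk h2, norm_mul, Complex.norm_real,
          Real.norm_of_nonneg (hd0 k hk h2)]
        exact mul_le_mul_of_nonneg_right (hd k hk h2).2 (norm_nonneg _)
      · rw [hbn k h2, hεn k h2, norm_zero, mul_zero])
    (fun k hk => by
      rcases le_or_gt k n with h2 | h2
      · have : (d k : ℂ) * (fhat k - 1) + (d k : ℂ) = (d k : ℂ) * fhat k := by ring
        rw [hbk k hk h2, hdk k hk h2, this, norm_mul, Complex.norm_real,
          Real.norm_of_nonneg (hd0 k hk h2)]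
        exact mul_le_of_le_one_right (hd0 k hk h2) (hfhat k hk h2)
      · rw [hbn k h2, hdn k h2]
        simp)
  have hp : ∀ j, j ≤ n → expCoeff d' j = cyclePartition d j := fun j hj => by
    rw [cyclePartition_eq]
    exact expCoeff_congr fun k h1 h2 => hdk k h1 (h2.trans hj)
  have hF : expCoeff (fun k => b k + (d' k : ℂ)) n = expCoeff (fun k => fhat k * (d k : ℂ)) n :=
    expCoeff_congr fun k h1 h2 => by
      rw [hbk k h1 h2, hdk k h1 h2]
      ring
  have hexp : expPoly b n 1 =
      Complex.exp (∑ k ∈ Finset.Icc 1 n, (d k : ℂ) * ((fhat k - 1) / (k : ℂ))) := by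
    rw [expPoly]
    congr 1
    refine Finset.sum_congr rfl fun k hk => ?_
    have hk := Finset.mem_Icc.1 hk
    rw [hbk k hk.1 hk.2, Complex.ofReal_one, one_pow]
    ring
  have hQ : ∑ j ∈ Finset.range (n + 1), expCoeff d' j =
      ∑ j ∈ Finset.range (n + 1), cyclePartition d j :=
    Finset.sum_congr rfl fun j hj => hp j (by have := Finset.mem_range.1 hj; omega)
  have hsum : ∀ u v : ℕ → ℝ, (∀ k, k ≤ n → u k = v k) →
      ∑ k ∈ Finset.Icc 1 n, ε k * u k = ∑ k ∈ Finset.Icc 1 n, ‖fhat k - 1‖ * v k := by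
    intro u v huv
    refine Finset.sum_congr rfl fun k hk => ?_
    have hk := Finset.mem_Icc.1 hk
    rw [hεk k hk.1 hk.2, huv k hk.2]
  have hE : ∑ k ∈ Finset.Icc 1 n, ε k = ∑ k ∈ Finset.Icc 1 n, ‖fhat k - 1‖ :=
    Finset.sum_congr rfl fun k hk => hεk k (Finset.mem_Icc.1 hk).1 (Finset.mem_Icc.1 hk).2
  rw [hF, hexp, hQ, hE, hsum _ _ fun k _ => hp (n - k) (Nat.sub_le n k), hsum _ _ fun k _ => rfl,
    hp n le_rfl, cyclePartition_eq, ← weightedMean_eq d f fhat hf] at hmain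
  exact hmain

end MeanValue

theorem mainTheorem1 (dm dp : ℝ) (hdm : 0 < dm) (hdp : dm ≤ dp) :
    ∃ c : ℝ, 0 < c ∧
      ∀ (n : ℕ), 1 ≤ n →
      ∀ (d : ℕ → ℝ), (∀ j : ℕ, 1 ≤ j → j ≤ n → dm ≤ d j ∧ d j ≤ dp) →
      ∀ (f : Equiv.Perm (Fin n) → ℂ) (fhat : ℕ → ℂ), IsMultiplicativeWith f fhat →
        (∀ j : ℕ, 1 ≤ j → j ≤ n → ‖fhat j‖ ≤ 1) →
        (dm < 1 →
          meanError d f fhat ≤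
            c * ((∑ j ∈ Finset.range (n + 1), cyclePartition d j)⁻¹ *
                    ∑ k ∈ Finset.Icc 1 n, ‖fhat k - 1‖ * cyclePartition d (n - k)
                + 1 / (n : ℝ) ^ dm *
                    ∑ k ∈ Finset.Icc 1 n, ‖fhat k - 1‖ * (k : ℝ) ^ (dm - 1)
                + 1 / (n : ℝ) * ∑ k ∈ Finset.Icc 1 n, ‖fhat k - 1‖)) ∧
        (1 ≤ dm →
          meanError d f fhat ≤
            c * ((∑ j ∈ Finset.range (n + 1), cyclePartition d j)⁻¹ *
                    ∑ k ∈ Finset.Icc 1 n, ‖fhat k - 1‖ * cyclePartition d (n - k)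
                + 1 / (n : ℝ) *
                    ∑ k ∈ Finset.Icc 1 n,
                      ‖fhat k - 1‖ * (1 + Real.log ((n : ℝ) / (k : ℝ))))) := by
  have hD : 0 < dp := hdm.trans_le hdp
  rcases lt_or_ge dm 1 with h1 | h1
  · obtain ⟨C, hC, h⟩ := meanError_le hdm h1.le hD
    set c := 1 + (2 + 2 * dp + 1) * (1 + 1 / (1 - dm)) with hc
    have hc1 : 1 ≤ c := by
      have : 0 < 1 - dm := by linarith
      have : 0 ≤ (2 + 2 * dp + 1) * (1 + 1 / (1 - dm)) := by positivity
      linarith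
    refine ⟨C * c, by positivity, fun n hn d hd f fhat hf hfhat =>
      ⟨fun _ => ?_, fun h2 => absurd h2 (not_le.2 h1)⟩⟩
    have hn0 : (0 : ℝ) < n := by exact_mod_cast hn
    refine (h n hn d hd f fhat hf hfhat).trans ?_
    rw [mul_assoc]
    refine mul_le_mul_of_nonneg_left ?_ hC.le
    have hp : ∀ j, j ≤ n → 0 ≤ cyclePartition d j := fun j hj => by
      rw [cyclePartition_eq]
      exact expCoeff_nonneg fun k hk hkj => hdm.le.trans (hd k hk (hkj.trans hj)).1
    have h3 : ∑ k ∈ Finset.Icc 1 n, ‖fhat k - 1‖ *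
        (∫ x in (0 : ℝ)..(1 - 1 / n), (1 - x) ^ (-dm) *
          (x ^ (k - 1) * (2 + 2 * dp + k * (1 - x)))) ≤
        c * ∑ k ∈ Finset.Icc 1 n, ‖fhat k - 1‖ * (k : ℝ) ^ (dm - 1) := by
      rw [Finset.mul_sum]
      refine Finset.sum_le_sum fun k hk => ?_
      have hk := Finset.mem_Icc.1 hk
      refine (mul_le_mul_of_nonneg_left
        (integral_kernel_le_of_lt_one hk.1 hk.2 hdm h1 (by positivity)) (norm_nonneg _)).trans
        (le_of_eq ?_)
      rw [← hc]
      ring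
    have h4 : 0 ≤ (∑ j ∈ Finset.range (n + 1), cyclePartition d j)⁻¹ *
        ∑ k ∈ Finset.Icc 1 n, ‖fhat k - 1‖ * cyclePartition d (n - k) :=
      mul_nonneg (inv_nonneg.2 (Finset.sum_nonneg fun j hj =>
        hp j (by have := Finset.mem_range.1 hj; omega)))
        (Finset.sum_nonneg fun k _ => mul_nonneg (norm_nonneg _) (hp _ (Nat.sub_le n k)))
    have h5 : 0 ≤ 1 / (n : ℝ) * ∑ k ∈ Finset.Icc 1 n, ‖fhat k - 1‖ := by positivity
    have h6 := mul_le_mul_of_nonneg_left h3 (Real.rpow_nonneg hn0.le (-dm))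
    rw [mul_add, mul_add, one_div ((n : ℝ) ^ dm), ← Real.rpow_neg hn0.le]
    refine add_le_add (add_le_add (le_mul_of_one_le_left h4 hc1) (h6.trans (le_of_eq ?_)))
      (le_mul_of_one_le_left h5 hc1)
    ring
  · obtain ⟨C, hC, h⟩ := meanError_le one_pos le_rfl hD
    set c := 2 + 2 * dp + 2 with hc
    have hc1 : 1 ≤ c := by linarith
    -- The additional `1` pays for the plain `1/n` sum, absorbed since `1 + log (n / k) ≥ 1`.
    refine ⟨C * (c + 1), by positivity, fun n hn d hd f fhat hf hfhat =>
      ⟨fun h2 => absurd h2 (not_lt.2 h1), fun _ => ?_⟩⟩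
    refine (h n hn d (fun j hj hjn => ⟨h1.trans (hd j hj hjn).1, (hd j hj hjn).2⟩) f fhat hf
      hfhat).trans ?_
    rw [mul_assoc]
    refine mul_le_mul_of_nonneg_left ?_ hC.le
    have hp : ∀ j, j ≤ n → 0 ≤ cyclePartition d j := fun j hj => by
      rw [cyclePartition_eq]
      exact expCoeff_nonneg fun k hk hkj => hdm.le.trans (hd k hk (hkj.trans hj)).1
    have h3 : ∑ k ∈ Finset.Icc 1 n, ‖fhat k - 1‖ *
        (∫ x in (0 : ℝ)..(1 - 1 / n), (1 - x) ^ (-1 : ℝ) *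
          (x ^ (k - 1) * (2 + 2 * dp + k * (1 - x)))) ≤
        c * ∑ k ∈ Finset.Icc 1 n, ‖fhat k - 1‖ * (1 + Real.log ((n : ℝ) / k)) := by
      rw [Finset.mul_sum]
      refine Finset.sum_le_sum fun k hk => ?_
      have hk := Finset.mem_Icc.1 hk
      refine (mul_le_mul_of_nonneg_left
        (integral_kernel_le_of_eq_one hk.1 hk.2 (by positivity)) (norm_nonneg _)).trans
        (le_of_eq ?_)
      rw [← hc]
      ring
    have h4 : 0 ≤ (∑ j ∈ Finset.range (n + 1), cyclePartition d j)⁻¹ *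
        ∑ k ∈ Finset.Icc 1 n, ‖fhat k - 1‖ * cyclePartition d (n - k) :=
      mul_nonneg (inv_nonneg.2 (Finset.sum_nonneg fun j hj =>
        hp j (by have := Finset.mem_range.1 hj; omega)))
        (Finset.sum_nonneg fun k _ => mul_nonneg (norm_nonneg _) (hp _ (Nat.sub_le n k)))
    have h5 : ∑ k ∈ Finset.Icc 1 n, ‖fhat k - 1‖ ≤
        ∑ k ∈ Finset.Icc 1 n, ‖fhat k - 1‖ * (1 + Real.log ((n : ℝ) / k)) := by
      refine Finset.sum_le_sum fun k hk => le_mul_of_one_le_right (norm_nonneg _) ?_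
      have hk := Finset.mem_Icc.1 hk
      have hk0 : (0 : ℝ) < k := by exact_mod_cast hk.1
      have : 0 ≤ Real.log ((n : ℝ) / k) :=
        Real.log_nonneg (by rw [one_le_div hk0]; exact_mod_cast hk.2)
      linarith
    have h6 := mul_le_mul_of_nonneg_left (add_le_add h3 h5)
      (by positivity : 0 ≤ 1 / (n : ℝ))
    rw [Real.rpow_neg_one, ← one_div (n : ℝ), add_assoc, ← mul_add (1 / (n : ℝ)), mul_add (c + 1)]
    refine add_le_add (le_mul_of_one_le_left h4 (show 1 ≤ c + 1 by linarith)) (h6.trans (le_of_eq ?_))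
    ring
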